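/- **Conventions.** Let $M$ be a complex manifold with sheaf $\mathcal O_M$ of holomorphic functions and sheaves $\Omega_M^j$ of holomorphic $j$-forms. Let $\mathfrak g=T_M[-1]\oplus\mathfrak g_2[-2]\oplus\cdots\oplus\mathfrak g_{N}[-N]$ be a graded holomorphic vector bundle of finite rank on $M$ whose degree-one part is the tangent bundle. Its shifted dual is $\mathfrak g^\vee[-1]=\Omega_M\oplus\mathcal W$, where $\mathcal W=(\mathfrak g^{\ge 2})^\vee[-1]$, so $\Omega_M$ sits in degree $0$ and $\mathfrak g_k^\vee$ in degree $-(k-1)$. Put $C^*\mathfrak g=\hat S(\mathfrak g^\vee[-1])=\hat S(\Omega_M)\otimes\hat S(\mathcal W)$, the completed graded symmetric algebra over $\mathcal O_M$; its grading is called the cohomological degree. A (possibly curved) $L_\infty$ structure on $\mathfrak g$ is an $\mathcal O_M$-linear derivation $Q$ of $C^*\mathfrak g$ of cohomological degree $1$ with $Q^2=0$. It is extended $\Omega_M^*$-linearly (with the Koszul sign) to $\Omega_M^*\otimes_{\mathcal O_M}C^*\mathfrak g$. A Grothendieck connection is a flat connection $D:C^*\mathfrak g\to\Omega_M\otimes C^*\mathfrak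 g$ of cohomological degree $0$ such that (a) $D(ab)=Da\cdot b+(-1)^{|a|}a\cdot Db$; (b) the component $\Omega_M\to\Omega_M\otimes 1$ of $D$ is $\alpha\mapsto\alpha\otimes 1$; (c) $[D,Q]=0$. It is extended to the de Rham complex $\Omega_M^*\otimes C^*\mathfrak g$ in the usual way. An $L_\infty$ space is a triple $(M,\mathfrak g,D)$ consisting of such an $M$, such a $\mathfrak g$ with an $L_\infty$ structure, and a Grothendieck connection $D$. Its Chevalley–Eilenberg complex is $$C^*(\mathfrak g,D)=\bigl(\Omega_M^*\otimes_{\mathcal O_M}C^*\mathfrak g,\;Q+D\bigr),$$ graded by the sum of the form degree and the cohomological degree. On $\hat S(\mathcal W)$, the Chevalley–Eilenberg algebra of the sub-$L_\infty$-algebra $\mathfrak g^{\ge2}\subset\mathfrak g$, denote again by $Q$ its Chevalley–Eilenberg differential, namely $Q$ followed by the projection $C^*\mathfrak g\to\hat S(\mathcal W)$ that sets the generators in $\Omega_M$ to zero. **Theorem 3.6.** Let $(M,\mathfrak g,D)$ be an $L_\infty$ space. Then $(\hat S(\mathcal W),Q)$ is a complex, and there exists a homotopy equivalence $$C^*(\mathfrak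 g,D)\;\simeq\;\bigl(\hat S(\mathcal W),Q\bigr)$$ of complexes of sheaves of complex vector spaces on $M$. -/

import Mathlib

open Bundle TopologicalSpace CategoryTheory Opposite
open scoped Manifold ContDiff TensorProduct

set_option linter.unusedSectionVars false

noncomputable section

namespace LInfty

/-! ### The fibre: the free graded-commutative algebra

`T` is a tangent space and `G k` (`k : Fin r`) is the fibre of `𝔤_{k+2}`, the summand of the graded
bundle `𝔤 = T[-1] ⊕ 𝔤_2[-2] ⊕ ⋯ ⊕ 𝔤_{r+1}[-(r+1)]` of degree `k + 2`.  The algebra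
`Λ T^∨ ⊗ S(𝔤^∨[-1])` is the free graded-commutative algebra on three kinds of generators:

* `α ∈ T^∨` as a differential form: form degree `1`, cohomological degree `0`;
* `α ∈ T^∨ = (T[-1])^∨[-1]` as a linear function on `𝔤[1]`: form degree `0`,
  cohomological degree `0`;
* `β ∈ (G k)^∨`, which is the piece `(𝔤_{k+2}[-(k+2)])^∨[-1]` of `𝒲 = (𝔤^{≥2})^∨[-1]`:
  form degree `0`, cohomological degree `-(k+1)`.

Signs follow the total degree (form degree plus cohomological degree), so the free
graded-commutative algebra is the symmetric algebra on the generators of even total degree,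
tensored with the exterior algebra on the generators of odd total degree. -/

section Fibre

variable (T : Type*) [AddCommGroup T] [Module ℂ T] [TopologicalSpace T] [IsTopologicalAddGroup T]
  [ContinuousSMul ℂ T]
  {r : ℕ} (G : Fin r → Type*) [∀ k, AddCommGroup (G k)] [∀ k, Module ℂ (G k)]
  [∀ k, TopologicalSpace (G k)] [∀ k, IsTopologicalAddGroup (G k)] [∀ k, ContinuousSMul ℂ (G k)]

/-- Generators of even total degree. -/
abbrev EvenGen : Type _ := (T →L[ℂ] ℂ) × (∀ k : {k : Fin r // Odd (k : ℕ)}, G k →L[ℂ] ℂ)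

/-- Generators of odd total degree. -/
abbrev OddGen : Type _ := (T →L[ℂ] ℂ) × (∀ k : {k : Fin r // Even (k : ℕ)}, G k →L[ℂ] ℂ)

/-- The (uncompleted) algebra `Λ T^∨ ⊗ S(T^∨ ⊕ 𝒲)`. -/
def FibreAlg : Type _ := SymmetricAlgebra ℂ (EvenGen T G) ⊗[ℂ] ExteriorAlgebra ℂ (OddGen T G)

instance : Ring (FibreAlg T G) :=
  inferInstanceAs (Ring (SymmetricAlgebra ℂ (EvenGen T G) ⊗[ℂ] ExteriorAlgebra ℂ (OddGen T G)))

instance : Algebra ℂ (FibreAlg T G) :=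
  inferInstanceAs (Algebra ℂ (SymmetricAlgebra ℂ (EvenGen T G) ⊗[ℂ] ExteriorAlgebra ℂ (OddGen T G)))

variable {T}

/-- A covector as a differential form. -/
def formGen (α : T →L[ℂ] ℂ) : FibreAlg T G :=
  (1 : SymmetricAlgebra ℂ (EvenGen T G)) ⊗ₜ[ℂ] ExteriorAlgebra.ι ℂ ((α, 0) : OddGen T G)

/-- A covector as a generator of the symmetric algebra. -/
def symGen (α : T →L[ℂ] ℂ) : FibreAlg T G :=
  SymmetricAlgebra.ι ℂ (EvenGen T G) (α, 0) ⊗ₜ[ℂ] (1 : ExteriorAlgebra ℂ (OddGen T G))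

variable (T) {G}

/-- The generator of cohomological degree `-(k+1)` given by an element of the dual of `G k`. -/
def wGen (k : Fin r) (β : G k →L[ℂ] ℂ) : FibreAlg T G :=
  if h : Odd (k : ℕ) then
    SymmetricAlgebra.ι ℂ (EvenGen T G)
      (0, Pi.single (M := fun k : {k : Fin r // Odd (k : ℕ)} ↦ G k →L[ℂ] ℂ) ⟨k, h⟩ β) ⊗ₜ[ℂ]
        (1 : ExteriorAlgebra ℂ (OddGen T G))
  else
    (1 : SymmetricAlgebra ℂ (EvenGen T G)) ⊗ₜ[ℂ] ExteriorAlgebra.ι ℂ ((0, Pi.single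
      (M := fun k : {k : Fin r // Even (k : ℕ)} ↦ G k →L[ℂ] ℂ)
      ⟨k, Nat.not_odd_iff_even.1 h⟩ β) : OddGen T G)

end Fibre

/-- Multidegrees `m`: `m 0` is the form degree, `m 1` is the number of factors from `Ω_M` in the
symmetric algebra, and `-(m 2)` is the cohomological degree. -/
abbrev Deg : Type := Fin 3 →₀ ℕ

variable (E : Type*) [NormedAddCommGroup E] [NormedSpace ℂ E]
  {M : Type*} [TopologicalSpace M] [ChartedSpace E M] [IsManifold 𝓘(ℂ, E) ω M]
  {r : ℕ} (F : Fin r → Type*) [∀ k, NormedAddCommGroup (F k)] [∀ k, NormedSpace ℂ (F k)]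
  (𝔤 : Fin r → M → Type*) [∀ k, TopologicalSpace (TotalSpace (F k) (𝔤 k))]
  [∀ k x, AddCommGroup (𝔤 k x)] [∀ k x, Module ℂ (𝔤 k x)] [∀ k x, TopologicalSpace (𝔤 k x)]
  [∀ k x, IsTopologicalAddGroup (𝔤 k x)] [∀ k x, ContinuousSMul ℂ (𝔤 k x)]
  [∀ k, FiberBundle (F k) (𝔤 k)] [∀ k, VectorBundle ℂ (F k) (𝔤 k)]

/-- The fibre at `x` of `Λ Ω_M ⊗ S(𝔤^∨[-1])`. -/
abbrev AlgAt (E : Type*) [NormedAddCommGroup E] [NormedSpace ℂ E]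
    {M : Type*} [TopologicalSpace M] [ChartedSpace E M]
    {r : ℕ} (𝔤 : Fin r → M → Type*)
    [∀ k x, AddCommGroup (𝔤 k x)] [∀ k x, Module ℂ (𝔤 k x)] [∀ k x, TopologicalSpace (𝔤 k x)]
    [∀ k x, IsTopologicalAddGroup (𝔤 k x)] [∀ k x, ContinuousSMul ℂ (𝔤 k x)] (x : M) : Type _ :=
  FibreAlg (TangentSpace 𝓘(ℂ, E) x) (fun k ↦ 𝔤 k x)

/-- Arbitrary sections over `U` of the bundle of algebras `Λ Ω_M ⊗ S(𝔤^∨[-1])`; algebra operations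
are pointwise. -/
def Sec (E : Type*) [NormedAddCommGroup E] [NormedSpace ℂ E]
    {M : Type*} [TopologicalSpace M] [ChartedSpace E M]
    {r : ℕ} (𝔤 : Fin r → M → Type*)
    [∀ k x, AddCommGroup (𝔤 k x)] [∀ k x, Module ℂ (𝔤 k x)] [∀ k x, TopologicalSpace (𝔤 k x)]
    [∀ k x, IsTopologicalAddGroup (𝔤 k x)] [∀ k x, ContinuousSMul ℂ (𝔤 k x)]
    (U : Opens M) : Type _ :=
  ∀ x : U, AlgAt E 𝔤 (x : M)

section Sec

variable (E : Type*) [NormedAddCommGroup E] [NormedSpace ℂ E]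
  {M : Type*} [TopologicalSpace M] [ChartedSpace E M]
  {r : ℕ} (𝔤 : Fin r → M → Type*)
  [∀ k x, AddCommGroup (𝔤 k x)] [∀ k x, Module ℂ (𝔤 k x)] [∀ k x, TopologicalSpace (𝔤 k x)]
  [∀ k x, IsTopologicalAddGroup (𝔤 k x)] [∀ k x, ContinuousSMul ℂ (𝔤 k x)]

instance (U : Opens M) : Ring (Sec E 𝔤 U) := inferInstanceAs (Ring (∀ x : U, AlgAt E 𝔤 (x : M)))

instance (U : Opens M) : Algebra ℂ (Sec E 𝔤 U) :=
  inferInstanceAs (Algebra ℂ (∀ x : U, AlgAt E 𝔤 (x : M)))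

/-- Restriction of sections. -/
def resSec {U V : Opens M} (h : V ≤ U) : Sec E 𝔤 U →ₐ[ℂ] Sec E 𝔤 V where
  toFun s x := s ⟨x, h x.2⟩
  map_one' := rfl
  map_mul' _ _ := rfl
  map_zero' := rfl
  map_add' _ _ := rfl
  commutes' _ := rfl

/-- Formal series `∑ₘ aₘ tᵐ` of sections over `U`.  The variables `t` only keep track of the
multidegree: a series stands for the element `(aₘ)ₘ` of a product over all multidegrees. -/
abbrev Series (U : Opens M) : Type _ := MvPowerSeries (Fin 3) (Sec E 𝔤 U)

end Sec

/-- `α` is a holomorphic section over `V` of the dual of the vector bundle `B`. -/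
def IsHolDual (E : Type*) [NormedAddCommGroup E] [NormedSpace ℂ E]
    {M : Type*} [TopologicalSpace M] [ChartedSpace E M]
    (F : Type*) [NormedAddCommGroup F] [NormedSpace ℂ F] {B : M → Type*}
    [TopologicalSpace (TotalSpace F B)] [∀ x, AddCommGroup (B x)] [∀ x, Module ℂ (B x)]
    [∀ x, TopologicalSpace (B x)] [FiberBundle F B] [VectorBundle ℂ F B]
    (V : Opens M) (α : ∀ x, B x →L[ℂ] ℂ) : Prop :=
  ContMDiffOn 𝓘(ℂ, E) (𝓘(ℂ, E).prod 𝓘(ℂ, F →L[ℂ] ℂ)) ω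
    (fun x ↦ TotalSpace.mk' (F →L[ℂ] ℂ) (E := fun x ↦ B x →L[ℂ] Bundle.Trivial M ℂ x) x (α x)) V

/-- `HolPoly E F 𝔤 V m s`: over `V`, the section `s` of the bundle of algebras
`Λ Ω_M ⊗ S(𝔤^∨[-1])` is a polynomial expression, homogeneous of multidegree `m`, in holomorphic
functions, holomorphic one-forms (as forms and as symmetric generators) and holomorphic sections of
the duals of the bundles `𝔤 k`. -/
inductive HolPoly (V : Opens M) : Deg → Sec E 𝔤 V → Prop
  | zero (m : Deg) : HolPoly V m 0
  | fn (f : M → ℂ) (hf : ContMDiffOn 𝓘(ℂ, E) 𝓘(ℂ, ℂ) ω f V) :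
      HolPoly V 0 (fun x ↦ algebraMap ℂ _ (f x))
  | form (α : ∀ x : M, TangentSpace 𝓘(ℂ, E) x →L[ℂ] ℂ) (hα : IsHolDual E E V α) :
      HolPoly V (Finsupp.single 0 1) (fun x ↦ formGen _ (α x))
  | sym (α : ∀ x : M, TangentSpace 𝓘(ℂ, E) x →L[ℂ] ℂ) (hα : IsHolDual E E V α) :
      HolPoly V (Finsupp.single 1 1) (fun x ↦ symGen _ (α x))
  | w (k : Fin r) (β : ∀ x : M, 𝔤 k x →L[ℂ] ℂ) (hβ : IsHolDual E (F k) V β) :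
      HolPoly V (Finsupp.single 2 ((k : ℕ) + 1)) (fun x ↦ wGen (G := fun k ↦ 𝔤 k x) _ k (β x))
  | add (m : Deg) (s t : Sec E 𝔤 V) :
      HolPoly V m s → HolPoly V m t → HolPoly V m (s + t)
  | mul (m n : Deg) (s t : Sec E 𝔤 V) :
      HolPoly V m s → HolPoly V n t → HolPoly V (m + n) (s * t)

/-- Holomorphic sections over `U` of the finite rank bundle of elements of multidegree `m`. -/
def IsHol (U : Opens M) (m : Deg) (s : Sec E 𝔤 U) : Prop :=
  ∀ x ∈ U, ∃ (V : Opens M) (h : V ≤ U), x ∈ V ∧ HolPoly E F 𝔤 V m (resSec E 𝔤 h s)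

variable {E F 𝔤} in
lemma HolPoly.res {V W : Opens M} (h : W ≤ V) {m : Deg} {s : Sec E 𝔤 V}
    (hs : HolPoly E F 𝔤 V m s) : HolPoly E F 𝔤 W m (resSec E 𝔤 h s) := by
  induction hs with
  | zero m => exact HolPoly.zero m
  | fn f hf => exact HolPoly.fn f (hf.mono h)
  | form α hα => exact HolPoly.form α (ContMDiffOn.mono hα h)
  | sym α hα => exact HolPoly.sym α (ContMDiffOn.mono hα h)
  | w k β hβ => exact HolPoly.w k β (ContMDiffOn.mono hβ h)
  | add m s t _ _ hs ht => exact HolPoly.add m _ _ hs ht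
  | mul m n s t _ _ hs ht => exact HolPoly.mul m n _ _ hs ht

variable {E F 𝔤} in
lemma IsHol.res {U V : Opens M} (h : V ≤ U) {m : Deg} {s : Sec E 𝔤 U}
    (hs : IsHol E F 𝔤 U m s) : IsHol E F 𝔤 V m (resSec E 𝔤 h s) := by
  intro x hx
  obtain ⟨W, hW, hxW, hp⟩ := hs x (h hx)
  exact ⟨W ⊓ V, inf_le_right, ⟨hxW, hx⟩, hp.res (inf_le_left : W ⊓ V ≤ W)⟩

variable {E F 𝔤} in
lemma IsHol.zero (U : Opens M) (m : Deg) : IsHol E F 𝔤 U m 0 :=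
  fun _ hx ↦ ⟨U, le_rfl, hx, HolPoly.zero m⟩

variable {E F 𝔤} in
lemma IsHol.add {U : Opens M} {m : Deg} {s t : Sec E 𝔤 U}
    (hs : IsHol E F 𝔤 U m s) (ht : IsHol E F 𝔤 U m t) : IsHol E F 𝔤 U m (s + t) := by
  intro x hx
  obtain ⟨V, hV, hxV, hp⟩ := hs x hx
  obtain ⟨W, hW, hxW, hq⟩ := ht x hx
  exact ⟨V ⊓ W, inf_le_left.trans hV, ⟨hxV, hxW⟩,
    HolPoly.add m _ _ (hp.res (inf_le_left : V ⊓ W ≤ V)) (hq.res (inf_le_right : V ⊓ W ≤ W))⟩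

variable {E F 𝔤} in
lemma IsHol.mul {U : Opens M} {m n : Deg} {s t : Sec E 𝔤 U}
    (hs : IsHol E F 𝔤 U m s) (ht : IsHol E F 𝔤 U n t) : IsHol E F 𝔤 U (m + n) (s * t) := by
  intro x hx
  obtain ⟨V, hV, hxV, hp⟩ := hs x hx
  obtain ⟨W, hW, hxW, hq⟩ := ht x hx
  exact ⟨V ⊓ W, inf_le_left.trans hV, ⟨hxV, hxW⟩,
    HolPoly.mul m n _ _ (hp.res (inf_le_left : V ⊓ W ≤ V)) (hq.res (inf_le_right : V ⊓ W ≤ W))⟩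

variable {E F 𝔤} in
lemma IsHol.const (U : Opens M) (c : ℂ) :
    IsHol E F 𝔤 U 0 (algebraMap ℂ (Sec E 𝔤 U) c) :=
  fun _ hx ↦ ⟨U, le_rfl, hx, HolPoly.fn (fun _ ↦ c) contMDiffOn_const⟩

/-- The sections over `U` of `Ω_M^* ⊗ C^*𝔤 = Λ Ω_M ⊗ Ŝ(𝔤^∨[-1])`: families `(aₘ)ₘ` of holomorphic
sections `aₘ` of multidegree `m`.  As `U` varies these form a sheaf of `ℂ`-algebras. -/
def CEAlg (U : Opens M) : Subalgebra ℂ (Series E 𝔤 U) where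
  carrier := {a | ∀ m, IsHol E F 𝔤 U m (MvPowerSeries.coeff m a)}
  zero_mem' m := by simpa using IsHol.zero U m
  one_mem' m := by
    classical
    rw [MvPowerSeries.coeff_one]
    split_ifs with h
    · subst h
      simpa using IsHol.const (E := E) (F := F) (𝔤 := 𝔤) U 1
    · exact IsHol.zero U m
  add_mem' ha hb m := by simpa using (ha m).add (hb m)
  mul_mem' {a b} ha hb m := by
    classical
    rw [MvPowerSeries.coeff_mul]
    refine Finset.sum_induction _ (IsHol E F 𝔤 U m) (fun _ _ ↦ IsHol.add) (IsHol.zero U m) ?_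
    intro p hp
    rw [← Finset.HasAntidiagonal.mem_antidiagonal.1 hp]
    exact (ha p.1).mul (hb p.2)
  algebraMap_mem' c m := by
    classical
    rw [MvPowerSeries.algebraMap_apply, MvPowerSeries.coeff_C]
    split_ifs with h
    · subst h
      exact IsHol.const U c
    · exact IsHol.zero U m

/-- Restriction of sections of `Ω_M^* ⊗ C^*𝔤`. -/
def res {U V : Opens M} (h : V ≤ U) : CEAlg E F 𝔤 U →ₗ[ℂ] CEAlg E F 𝔤 V where
  toFun a := ⟨MvPowerSeries.map (resSec E 𝔤 h : _ →ₐ[ℂ] _).toRingHom a.1, fun m ↦ by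
    rw [MvPowerSeries.coeff_map]
    exact (a.2 m).res h⟩
  map_add' a b := by ext; simp
  map_smul' c a := by
    apply Subtype.ext
    ext m : 1
    simp only [MvPowerSeries.coeff_map]
    rfl

/-- The coefficients of `trunc S a`. -/
def truncFun {U : Opens M} (S : Deg → Prop) (a : Series E 𝔤 U) : Series E 𝔤 U :=
  open Classical in fun m ↦ if S m then MvPowerSeries.coeff m a else 0

lemma coeff_truncFun_of_pos {U : Opens M} {S : Deg → Prop} {m : Deg} (h : S m)
    (a : Series E 𝔤 U) :
    MvPowerSeries.coeff m (truncFun E 𝔤 S a) = MvPowerSeries.coeff m a :=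
  if_pos h

lemma coeff_truncFun_of_neg {U : Opens M} {S : Deg → Prop} {m : Deg} (h : ¬ S m)
    (a : Series E 𝔤 U) :
    MvPowerSeries.coeff m (truncFun E 𝔤 S a) = 0 :=
  if_neg h

/-- `trunc S a` keeps the components of `a` whose multidegree satisfies `S` and drops the others. -/
def trunc {U : Opens M} (S : Deg → Prop) : CEAlg E F 𝔤 U →ₗ[ℂ] CEAlg E F 𝔤 U where
  toFun a := ⟨truncFun E 𝔤 S a.1, fun m ↦ by
    by_cases h : S m
    · rw [coeff_truncFun_of_pos E 𝔤 h]
      exact a.2 m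
    · rw [coeff_truncFun_of_neg E 𝔤 h]
      exact IsHol.zero U m⟩
  map_add' a b := by
    apply Subtype.ext
    ext m : 1
    by_cases h : S m
    · simp [coeff_truncFun_of_pos E 𝔤 h]
    · simp [coeff_truncFun_of_neg E 𝔤 h]
  map_smul' c a := by
    apply Subtype.ext
    ext m : 1
    show MvPowerSeries.coeff m (truncFun E 𝔤 S (c • a.1)) =
      c • MvPowerSeries.coeff m (truncFun E 𝔤 S a.1)
    by_cases h : S m
    · rw [coeff_truncFun_of_pos E 𝔤 h, coeff_truncFun_of_pos E 𝔤 h]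
      rfl
    · rw [coeff_truncFun_of_neg E 𝔤 h, coeff_truncFun_of_neg E 𝔤 h, smul_zero]

/-- The elements all of whose components have a multidegree satisfying `S`. -/
def supp (U : Opens M) (S : Deg → Prop) : Submodule ℂ (CEAlg E F 𝔤 U) where
  carrier := {a | ∀ m, ¬ S m → MvPowerSeries.coeff m a.1 = 0}
  zero_mem' m _ := by simp
  add_mem' ha hb m hm := by simp [ha m hm, hb m hm]
  smul_mem' c a ha m hm := by
    show c • MvPowerSeries.coeff m a.1 = 0
    rw [ha m hm, smul_zero]

/-- Form degree `j` and cohomological degree `-i`. -/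
def bideg (j i : ℕ) (m : Deg) : Prop := m 0 = j ∧ m 2 = i

variable [∀ k, ContMDiffVectorBundle ω (F k) (𝔤 k) 𝓘(ℂ, E)]

/-- A (possibly curved) `L_∞` structure on the graded holomorphic vector bundle
`𝔤 = T_M[-1] ⊕ 𝔤_2[-2] ⊕ ⋯`: a derivation `Q` of cohomological degree `1` and square zero of its
Chevalley--Eilenberg algebra `C^*𝔤 = Ŝ(𝔤^∨[-1])`.  We record directly the `Ω_M^*`-linear extension
of `Q` to `Ω_M^* ⊗ C^*𝔤` (with the Koszul sign).  Linearity over `Ω_M^*` need not be required: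
`Q` kills functions and forms since `Ω_M^* ⊗ C^*𝔤` vanishes in positive cohomological degree. -/
structure LInftyStructure (E : Type*) [NormedAddCommGroup E] [NormedSpace ℂ E]
    {M : Type*} [TopologicalSpace M] [ChartedSpace E M] [IsManifold 𝓘(ℂ, E) ω M]
    {r : ℕ} (F : Fin r → Type*) [∀ k, NormedAddCommGroup (F k)] [∀ k, NormedSpace ℂ (F k)]
    (𝔤 : Fin r → M → Type*) [∀ k, TopologicalSpace (TotalSpace (F k) (𝔤 k))]
    [∀ k x, AddCommGroup (𝔤 k x)] [∀ k x, Module ℂ (𝔤 k x)] [∀ k x, TopologicalSpace (𝔤 k x)]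
    [∀ k x, IsTopologicalAddGroup (𝔤 k x)] [∀ k x, ContinuousSMul ℂ (𝔤 k x)]
    [∀ k, FiberBundle (F k) (𝔤 k)] [∀ k, VectorBundle ℂ (F k) (𝔤 k)]
    [∀ k, ContMDiffVectorBundle ω (F k) (𝔤 k) 𝓘(ℂ, E)] where
  Q : ∀ U : Opens M, CEAlg E F 𝔤 U →ₗ[ℂ] CEAlg E F 𝔤 U
  Q_res : ∀ {U V : Opens M} (h : V ≤ U) (a : CEAlg E F 𝔤 U),
    Q V (res E F 𝔤 h a) = res E F 𝔤 h (Q U a)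
  /-- `Q` preserves the form degree and raises the cohomological degree by one. -/
  Q_deg : ∀ (U : Opens M) (j i : ℕ) (a : CEAlg E F 𝔤 U),
    trunc E F 𝔤 (bideg j i) (Q U a) = Q U (trunc E F 𝔤 (bideg j (i + 1)) a)
  Q_mul : ∀ (U : Opens M) (j i : ℕ) (a b : CEAlg E F 𝔤 U), a ∈ supp E F 𝔤 U (bideg j i) →
    Q U (a * b) = Q U a * b + (-1 : ℂ) ^ (j + i) • (a * Q U b)
  Q_sq : ∀ (U : Opens M) (a : CEAlg E F 𝔤 U), Q U (Q U a) = 0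

variable {E F 𝔤}

/-- A Grothendieck connection: a flat connection `D : C^*𝔤 → Ω_M ⊗ C^*𝔤` of cohomological degree
zero which is a derivation, satisfies the normalisation `D_sym`, and commutes (in the graded sense)
with `Q`.  We record directly its extension to the de Rham complex `Ω_M^* ⊗ C^*𝔤`, an odd
derivation of square zero with `D f = df` on functions; it follows that `D` is the de Rham
differential on `Ω_M^*`. -/
structure GrothendieckConnection (L : LInftyStructure E F 𝔤) where
  D : ∀ U : Opens M, CEAlg E F 𝔤 U →ₗ[ℂ] CEAlg E F 𝔤 U
  D_res : ∀ {U V : Opens M} (h : V ≤ U) (a : CEAlg E F 𝔤 U),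
    D V (res E F 𝔤 h a) = res E F 𝔤 h (D U a)
  /-- `D` raises the form degree by one and preserves the cohomological degree. -/
  D_deg : ∀ (U : Opens M) (j i : ℕ) (a : CEAlg E F 𝔤 U),
    trunc E F 𝔤 (bideg (j + 1) i) (D U a) = D U (trunc E F 𝔤 (bideg j i) a)
  D_deg_zero : ∀ (U : Opens M) (i : ℕ) (a : CEAlg E F 𝔤 U),
    trunc E F 𝔤 (bideg 0 i) (D U a) = 0
  D_mul : ∀ (U : Opens M) (j i : ℕ) (a b : CEAlg E F 𝔤 U), a ∈ supp E F 𝔤 U (bideg j i) →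
    D U (a * b) = D U a * b + (-1 : ℂ) ^ (j + i) • (a * D U b)
  /-- `D f = df` for a holomorphic function `f`. -/
  D_fn : ∀ (U : Opens M) (a : CEAlg E F 𝔤 U) (f : M → ℂ),
    ContMDiffOn 𝓘(ℂ, E) 𝓘(ℂ, ℂ) ω f U →
    a.1 = MvPowerSeries.monomial 0 (fun x : U ↦ algebraMap ℂ (AlgAt E 𝔤 (x : M)) (f x)) →
    (D U a).1 = MvPowerSeries.monomial (Finsupp.single 0 1)
      (fun x : U ↦ formGen (fun k ↦ 𝔤 k x) (mfderiv 𝓘(ℂ, E) 𝓘(ℂ, ℂ) f (x : M)))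
  /-- The component `Ω_M → Ω_M ⊗ 1` of `D` is `α ↦ α ⊗ 1`. -/
  D_sym : ∀ (U : Opens M) (a : CEAlg E F 𝔤 U)
    (α : ∀ x : M, TangentSpace 𝓘(ℂ, E) x →L[ℂ] ℂ), IsHolDual E E U α →
    a.1 = MvPowerSeries.monomial (Finsupp.single 1 1)
      (fun x : U ↦ symGen (fun k ↦ 𝔤 k x) (α x)) →
    MvPowerSeries.coeff (Finsupp.single 0 1) (D U a).1 =
      (fun x : U ↦ formGen (fun k ↦ 𝔤 k x) (α x))
  D_sq : ∀ (U : Opens M) (a : CEAlg E F 𝔤 U), D U (D U a) = 0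
  D_Q : ∀ (U : Opens M) (a : CEAlg E F 𝔤 U), D U (L.Q U a) + L.Q U (D U a) = 0

/-- Total degree `n`, the sum of the form degree and the cohomological degree. -/
def totDeg (n : ℤ) (m : Deg) : Prop := (m 0 : ℤ) - m 2 = n

/-- No factor from `Ω_M`, neither as a form nor as a symmetric generator. -/
def wOnly (m : Deg) : Prop := m 0 = 0 ∧ m 1 = 0

/-- Multidegrees of the piece of `Ŝ(𝒲)` of cohomological degree `n`. -/
def wDeg (n : ℤ) (m : Deg) : Prop := wOnly m ∧ -(m 2 : ℤ) = n

variable {L : LInftyStructure E F 𝔤}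

lemma trunc_eq_zero {U : Opens M} {S S' : Deg → Prop} (h : ∀ m, S' m → ¬ S m)
    {a : CEAlg E F 𝔤 U} (ha : a ∈ supp E F 𝔤 U S) : trunc E F 𝔤 S' a = 0 := by
  apply Subtype.ext
  ext m : 1
  show MvPowerSeries.coeff m (truncFun E 𝔤 S' a.1) = MvPowerSeries.coeff m 0
  by_cases hm : S' m
  · rw [coeff_truncFun_of_pos E 𝔤 hm, ha m (h m hm)]
    rfl
  · rw [coeff_truncFun_of_neg E 𝔤 hm]
    rfl

lemma coeff_eq_trunc {U : Opens M} {S : Deg → Prop} {m : Deg} (hm : S m) (a : CEAlg E F 𝔤 U) :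
    MvPowerSeries.coeff m a.1 = MvPowerSeries.coeff m (trunc E F 𝔤 S a).1 :=
  (coeff_truncFun_of_pos E 𝔤 hm a.1).symm

lemma coeff_Q_eq_zero (L : LInftyStructure E F 𝔤) {U : Opens M} {S : Deg → Prop}
    {a : CEAlg E F 𝔤 U} (ha : a ∈ supp E F 𝔤 U S) {m : Deg}
    (h : ∀ m', bideg (m 0) (m 2 + 1) m' → ¬ S m') : MvPowerSeries.coeff m (L.Q U a).1 = 0 := by
  rw [coeff_eq_trunc (S := bideg (m 0) (m 2)) ⟨rfl, rfl⟩, L.Q_deg, trunc_eq_zero h ha, map_zero]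
  rfl

lemma coeff_D_eq_zero (D : GrothendieckConnection L) {U : Opens M} {S : Deg → Prop}
    {a : CEAlg E F 𝔤 U} (ha : a ∈ supp E F 𝔤 U S) {m : Deg}
    (h : ∀ m', m' 0 + 1 = m 0 → m' 2 = m 2 → ¬ S m') :
    MvPowerSeries.coeff m (D.D U a).1 = 0 := by
  rcases hm : m 0 with _ | j
  · rw [coeff_eq_trunc (S := bideg 0 (m 2)) ⟨hm, rfl⟩, D.D_deg_zero]
    rfl
  · rw [coeff_eq_trunc (S := bideg (j + 1) (m 2)) ⟨hm, rfl⟩, D.D_deg,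
      trunc_eq_zero (fun m' hm' ↦ h m' (by rw [hm'.1, hm]) hm'.2) ha, map_zero]
    rfl

/-- The total differential `Q + D`. -/
def totD (D : GrothendieckConnection L) (U : Opens M) : CEAlg E F 𝔤 U →ₗ[ℂ] CEAlg E F 𝔤 U :=
  L.Q U + D.D U

lemma totD_mem (D : GrothendieckConnection L) {U : Opens M} {i j : ℤ} (hij : i + 1 = j)
    {a : CEAlg E F 𝔤 U} (ha : a ∈ supp E F 𝔤 U (totDeg i)) :
    totD D U a ∈ supp E F 𝔤 U (totDeg j) := by
  refine Submodule.add_mem _ (fun m hm ↦ coeff_Q_eq_zero L ha ?_)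
    (fun m hm ↦ coeff_D_eq_zero D ha ?_)
  · rintro m' ⟨h0, h2⟩ h
    apply hm
    simp only [totDeg] at h ⊢
    omega
  · intro m' h0 h2 h
    apply hm
    simp only [totDeg] at h ⊢
    omega

lemma totD_totD (D : GrothendieckConnection L) (U : Opens M) (a : CEAlg E F 𝔤 U) :
    totD D U (totD D U a) = 0 := by
  have h := D.D_Q U a
  simp only [totD, LinearMap.add_apply, map_add, L.Q_sq, D.D_sq, zero_add, add_zero]
  exact h

lemma res_mem {U V : Opens M} (h : V ≤ U) {S : Deg → Prop} {a : CEAlg E F 𝔤 U}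
    (ha : a ∈ supp E F 𝔤 U S) : res E F 𝔤 h a ∈ supp E F 𝔤 V S := by
  intro m hm
  show MvPowerSeries.coeff m (MvPowerSeries.map _ a.1) = 0
  rw [MvPowerSeries.coeff_map, ha m hm, map_zero]

variable (E F 𝔤) in
/-- The sheaf of complex vector spaces `U ↦ {a ∈ (Ω_M^* ⊗ C^*𝔤)(U) | a` has multidegrees in `S}`. -/
def suppSheaf (S : Deg → Prop) : TopCat.Presheaf (ModuleCat ℂ) (TopCat.of M) where
  obj U := ModuleCat.of ℂ (supp E F 𝔤 U.unop S)
  map {U V} f := ModuleCat.ofHom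
    ((res E F 𝔤 (leOfHom f.unop)).restrict (p := supp E F 𝔤 U.unop S) (q := supp E F 𝔤 V.unop S)
      (fun _ ha ↦ res_mem _ ha))
  map_id _ := rfl
  map_comp _ _ := rfl

/-- The morphism of sheaves induced by operators that send `S` to `S'`. -/
def suppMap {S S' : Deg → Prop} (f : ∀ U : Opens M, CEAlg E F 𝔤 U →ₗ[ℂ] CEAlg E F 𝔤 U)
    (hres : ∀ {U V : Opens M} (h : V ≤ U) (a : CEAlg E F 𝔤 U),
      f V (res E F 𝔤 h a) = res E F 𝔤 h (f U a))
    (hf : ∀ (U : Opens M) (a : CEAlg E F 𝔤 U), a ∈ supp E F 𝔤 U S → f U a ∈ supp E F 𝔤 U S') :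
    suppSheaf E F 𝔤 S ⟶ suppSheaf E F 𝔤 S' where
  app U := ModuleCat.ofHom ((f U.unop).restrict (hf U.unop))
  naturality U V g := by
    ext a
    apply Subtype.ext
    exact hres (leOfHom g.unop) a.1

/-- The Chevalley--Eilenberg complex `C^*(𝔤, D)`: the de Rham complex `Ω_M^* ⊗ C^*𝔤` with the total
differential `Q + D`, graded by total degree, a complex of sheaves of complex vector spaces.
(Complexes of sheaves are a full subcategory of complexes of presheaves.) -/
def ceComplex (D : GrothendieckConnection L) :
    CochainComplex (TopCat.Presheaf (ModuleCat ℂ) (TopCat.of M)) ℤ where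
  X n := suppSheaf E F 𝔤 (totDeg n)
  d i j := if h : i + 1 = j then
      suppMap (totD D) (fun h a ↦ by
        simp only [totD, LinearMap.add_apply, L.Q_res, D.D_res, map_add])
        (fun _ _ ha ↦ totD_mem D h ha)
    else 0
  shape i j h := dif_neg h
  d_comp_d' i j k hij hjk := by
    rw [dif_pos (show i + 1 = j from hij), dif_pos (show j + 1 = k from hjk)]
    ext U a
    apply Subtype.ext
    exact totD_totD D _ _

/-- The differential of `Ŝ(𝒲)`, the Chevalley--Eilenberg differential of the sub-`L_∞`-algebra
`𝔤^{≥2}` of `𝔤`.  On `Ŝ(𝒲) ⊆ C^*𝔤` it is `Q` followed by the restriction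
`C^*𝔤 → C^*(𝔤^{≥2}) = Ŝ(𝒲)`, which sets the generators in `Ω_M` to zero. -/
def wQ (L : LInftyStructure E F 𝔤) (U : Opens M) : CEAlg E F 𝔤 U →ₗ[ℂ] CEAlg E F 𝔤 U :=
  trunc E F 𝔤 wOnly ∘ₗ L.Q U

lemma wQ_mem (L : LInftyStructure E F 𝔤) {U : Opens M} {i j : ℤ} (hij : i + 1 = j)
    {a : CEAlg E F 𝔤 U} (ha : a ∈ supp E F 𝔤 U (wDeg i)) :
    wQ L U a ∈ supp E F 𝔤 U (wDeg j) := by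
  intro m hm
  show MvPowerSeries.coeff m (truncFun E 𝔤 wOnly (L.Q U a).1) = 0
  by_cases hw : wOnly m
  · rw [coeff_truncFun_of_pos E 𝔤 hw]
    refine coeff_Q_eq_zero L ha ?_
    rintro m' ⟨h0, h2⟩ ⟨-, h⟩
    refine hm ⟨hw, ?_⟩
    omega
  · exact coeff_truncFun_of_neg E 𝔤 hw _

lemma wQ_res (L : LInftyStructure E F 𝔤) {U V : Opens M} (h : V ≤ U) (a : CEAlg E F 𝔤 U) :
    wQ L V (res E F 𝔤 h a) = res E F 𝔤 h (wQ L U a) := by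
  apply Subtype.ext
  ext m : 1
  show MvPowerSeries.coeff m (truncFun E 𝔤 wOnly (L.Q V (res E F 𝔤 h a)).1) =
    MvPowerSeries.coeff m (MvPowerSeries.map _ (truncFun E 𝔤 wOnly (L.Q U a).1))
  rw [L.Q_res, MvPowerSeries.coeff_map]
  by_cases hw : wOnly m
  · rw [coeff_truncFun_of_pos E 𝔤 hw, coeff_truncFun_of_pos E 𝔤 hw]
    exact MvPowerSeries.coeff_map _ _ _
  · rw [coeff_truncFun_of_neg E 𝔤 hw, coeff_truncFun_of_neg E 𝔤 hw, map_zero]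

/-- The complex `(Ŝ(𝒲), Q)`, given that its differential has square zero. -/
def wComplex (L : LInftyStructure E F 𝔤)
    (hL : ∀ (n : ℤ) (U : Opens M), ∀ a ∈ supp E F 𝔤 U (wDeg n), wQ L U (wQ L U a) = 0) :
    CochainComplex (TopCat.Presheaf (ModuleCat ℂ) (TopCat.of M)) ℤ where
  X n := suppSheaf E F 𝔤 (wDeg n)
  d i j := if h : i + 1 = j then
      suppMap (wQ L) (wQ_res L) (fun _ _ ha ↦ wQ_mem L h ha)
    else 0
  shape i j h := dif_neg h
  d_comp_d' i j k hij hjk := by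
    rw [dif_pos (show i + 1 = j from hij), dif_pos (show j + 1 = k from hjk)]
    ext U a
    apply Subtype.ext
    exact hL i _ a.1 a.2

end LInfty
end

/-! Write `d = Q + D`, let `π` be the projection to `Ŝ(𝒲)`, and call `y` the symmetric generators
from `Ω_M`. The leading part of `d` is the Koszul differential `δ` (`kosz`), the odd derivation
sending `y_α` to the form `α` and killing the other generators. The adjoint derivation sends forms
back to `y`'s; the anticommutator of the two counts forms and `y`'s together. Dividing by that count
gives an operator `h` with `δh + hδ = 1 - π`, a formal Poincaré lemma (`kosz_koszHomotopy`).

Filter by the number of `y`'s. Then `h` raises the filtration by one, while `d - δ` does not lower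
it (`totD_sub_kosz_mem_symFilt`). Indeed `Q` kills every `y` for degree reasons, and the
normalisation of `D` gives `D y_α = α` up to filtration one. Locally an element of filtration `n +
1` is a finite sum `∑ yᵢ bᵢ` with `bᵢ` of filtration `n`, even if it is an infinite series
(`sum_symEl_mul_frameDiv`). So the Leibniz rule and induction suffice, and no continuity of `Q` or
`D` is needed.

Hence `u = dh + hd - (1 - π)` raises the filtration, and `1 + u` is invertible by a Neumann series
that is finite in each multidegree. The map `π` intertwines `d` with the differential of `Ŝ(𝒲)`. On
`ker π` the operator `1 + u` is `dh + hd`, which commutes with `d`, so `c = h(1 + u)⁻¹` contracts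
`ker π` (`totD_contraction`).

A projection with contractible kernel is a homotopy equivalence: correcting the linear inclusion of
`Ŝ(𝒲)` by `c` gives a chain map `ι` with `πι = 1`, and `c(1 - ιπ)` is a homotopy from `1` to `ιπ`.
All operators commute with restriction, so this happens on the level of sheaves. -/

noncomputable section

namespace LInfty

/-! ### Derivations of the symmetric algebra -/

section SymmetricDerivation

variable {V : Type*} [AddCommGroup V] [Module ℂ V]

/-- The algebra morphism `a ↦ a + ε ∂a` to the dual numbers over the symmetric algebra, where `∂` is
the directional derivative along a linear functional. -/
def symDual (f : V →ₗ[ℂ] ℂ) :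
    SymmetricAlgebra ℂ V →ₐ[ℂ] TrivSqZeroExt (SymmetricAlgebra ℂ V) (SymmetricAlgebra ℂ V) :=
  SymmetricAlgebra.lift
    ((TrivSqZeroExt.inlAlgHom ℂ (SymmetricAlgebra ℂ V) (SymmetricAlgebra ℂ V)).toLinearMap ∘ₗ
        SymmetricAlgebra.ι ℂ V +
      (TrivSqZeroExt.inrHom (SymmetricAlgebra ℂ V) (SymmetricAlgebra ℂ V)).restrictScalars ℂ ∘ₗ
        Algebra.linearMap ℂ (SymmetricAlgebra ℂ V) ∘ₗ f)

lemma symDual_ι (f : V →ₗ[ℂ] ℂ) (v : V) : symDual f (SymmetricAlgebra.ι ℂ V v) =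
    TrivSqZeroExt.inl (SymmetricAlgebra.ι ℂ V v) + TrivSqZeroExt.inr (algebraMap ℂ _ (f v)) := by
  simp [symDual]

/-- An algebra morphism to the dual numbers has a derivation as second component once its first
component is the identity; it is enough to check this on generators. -/
lemma fst_symDual (f : V →ₗ[ℂ] ℂ) (a : SymmetricAlgebra ℂ V) : (symDual f a).fst = a := by
  have h : (TrivSqZeroExt.fstHom ℂ (SymmetricAlgebra ℂ V) (SymmetricAlgebra ℂ V)).comp
      (symDual f) = AlgHom.id ℂ _ := by
    apply SymmetricAlgebra.algHom_ext
    ext v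
    simp [symDual_ι]
  exact DFunLike.congr_fun h a

/-- The derivation of the symmetric algebra extending a linear functional on the generators. -/
def symDer (f : V →ₗ[ℂ] ℂ) : SymmetricAlgebra ℂ V →ₗ[ℂ] SymmetricAlgebra ℂ V :=
  (TrivSqZeroExt.sndHom (SymmetricAlgebra ℂ V) (SymmetricAlgebra ℂ V)).restrictScalars ℂ ∘ₗ
    (symDual f).toLinearMap

lemma symDer_ι (f : V →ₗ[ℂ] ℂ) (v : V) :
    symDer f (SymmetricAlgebra.ι ℂ V v) = algebraMap ℂ _ (f v) := by
  simp [symDer, symDual_ι, Algebra.algebraMap_eq_smul_one]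

lemma symDer_mul (f : V →ₗ[ℂ] ℂ) (a b : SymmetricAlgebra ℂ V) :
    symDer f (a * b) = symDer f a * b + a * symDer f b := by
  simp only [symDer, LinearMap.comp_apply, AlgHom.toLinearMap_apply, map_mul,
    LinearMap.restrictScalars_apply, TrivSqZeroExt.sndHom_apply, TrivSqZeroExt.snd_mul,
    fst_symDual, smul_eq_mul, MulOpposite.smul_eq_mul_unop, MulOpposite.unop_op]
  ring

lemma symDer_one (f : V →ₗ[ℂ] ℂ) : symDer f 1 = 0 := by
  simpa using symDer_mul f 1 1

end SymmetricDerivation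

/-! ### Signs in the exterior algebra -/

section Exterior

variable {V : Type*} [AddCommGroup V] [Module ℂ V]

open CliffordAlgebra in
lemma exterior_contract_mul (f : Module.Dual ℂ V) (a b : ExteriorAlgebra ℂ V) :
    contractLeft f (a * b) = contractLeft f a * b + involute a * contractLeft f b := by
  induction a using CliffordAlgebra.left_induction with
  | algebraMap r => simp [contractLeft_algebraMap, contractLeft_algebraMap_mul]
  | add x y hx hy => simp only [add_mul, map_add, hx, hy]; abel
  | ι_mul x m hx =>
    simp only [mul_assoc, contractLeft_ι_mul, hx, map_mul, involute_ι, sub_mul, mul_add,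
      smul_mul_assoc, neg_mul]
    abel

open CliffordAlgebra in
-- Each generator that `v` passes costs a sign, and `involute` collects these signs.
lemma exterior_ι_mul (v : V) (a : ExteriorAlgebra ℂ V) :
    ExteriorAlgebra.ι ℂ v * a = involute a * ExteriorAlgebra.ι ℂ v := by
  induction a using CliffordAlgebra.left_induction with
  | algebraMap r =>
    rw [AlgHom.commutes]
    exact (Algebra.commutes r _).symm
  | add x y hx hy => simp only [add_mul, map_add, mul_add, hx, hy]
  | ι_mul x m hx =>
    have h : ExteriorAlgebra.ι ℂ v * ExteriorAlgebra.ι ℂ m =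
        -(ExteriorAlgebra.ι ℂ m * ExteriorAlgebra.ι ℂ v) :=
      eq_neg_of_add_eq_zero_left (ExteriorAlgebra.ι_add_mul_swap v m)
    have hι : CliffordAlgebra.ι (0 : QuadraticForm ℂ V) m = ExteriorAlgebra.ι ℂ m := rfl
    rw [hι] at *
    rw [← mul_assoc, h, neg_mul, mul_assoc, hx, map_mul, ← hι, involute_ι, hι, neg_mul, neg_mul,
      mul_assoc]

open CliffordAlgebra in
lemma exterior_contract_involute (f : Module.Dual ℂ V) (b : ExteriorAlgebra ℂ V) :
    contractLeft f (involute b) = -involute (contractLeft f b) := by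
  induction b using CliffordAlgebra.left_induction with
  | algebraMap r => rw [AlgHom.commutes, contractLeft_algebraMap, map_zero, neg_zero]
  | add x y hx hy => rw [map_add, map_add, hx, hy, map_add, map_add, neg_add]
  | ι_mul x m hx =>
    rw [map_mul, involute_ι, neg_mul, map_neg, contractLeft_ι_mul, hx, contractLeft_ι_mul, map_sub,
      map_smul, map_mul, involute_ι, mul_neg, neg_mul]

end Exterior

/-! ### Parity and contractions on the fibre algebra -/

section FibreOperators

variable {T : Type*} [AddCommGroup T] [Module ℂ T] [TopologicalSpace T] [IsTopologicalAddGroup T]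
  [ContinuousSMul ℂ T]
  {r : ℕ} {G : Fin r → Type*} [∀ k, AddCommGroup (G k)] [∀ k, Module ℂ (G k)]
  [∀ k, TopologicalSpace (G k)] [∀ k, IsTopologicalAddGroup (G k)] [∀ k, ContinuousSMul ℂ (G k)]

instance : AddCommGroup (EvenGen T G) := inferInstance
instance : Module ℂ (EvenGen T G) := inferInstance
instance : AddCommGroup (OddGen T G) := inferInstance
instance : Module ℂ (OddGen T G) := inferInstance

/-- The product of a polynomial in the even generators and one in the odd generators. -/
def FibreAlg.mk (a : SymmetricAlgebra ℂ (EvenGen T G)) (b : ExteriorAlgebra ℂ (OddGen T G)) :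
    FibreAlg T G :=
  (a ⊗ₜ[ℂ] b : SymmetricAlgebra ℂ (EvenGen T G) ⊗[ℂ] ExteriorAlgebra ℂ (OddGen T G))

namespace FibreAlg

lemma induction {P : FibreAlg T G → Prop} (mk : ∀ a b, P (mk a b))
    (add : ∀ a b, P a → P b → P (a + b)) (a : FibreAlg T G) : P a := by
  refine TensorProduct.induction_on (motive := P) a ?_ mk add
  have : P (FibreAlg.mk 0 0) := mk 0 0
  rwa [FibreAlg.mk, TensorProduct.zero_tmul] at this

lemma mk_mul_mk (a a' : SymmetricAlgebra ℂ (EvenGen T G))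
    (b b' : ExteriorAlgebra ℂ (OddGen T G)) : mk a b * mk a' b' = mk (a * a') (b * b') :=
  Algebra.TensorProduct.tmul_mul_tmul a a' b b'

lemma mk_one_one : mk (1 : SymmetricAlgebra ℂ (EvenGen T G)) 1 = 1 := rfl

lemma mk_zero_left (b : ExteriorAlgebra ℂ (OddGen T G)) :
    mk (0 : SymmetricAlgebra ℂ (EvenGen T G)) b = 0 :=
  TensorProduct.zero_tmul _ b

lemma mk_zero_right (a : SymmetricAlgebra ℂ (EvenGen T G)) :
    mk a (0 : ExteriorAlgebra ℂ (OddGen T G)) = 0 :=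
  TensorProduct.tmul_zero _ a

lemma mk_neg_right (a : SymmetricAlgebra ℂ (EvenGen T G)) (b : ExteriorAlgebra ℂ (OddGen T G)) :
    mk a (-b) = -mk a b :=
  TensorProduct.tmul_neg a b

lemma mk_add_left (a a' : SymmetricAlgebra ℂ (EvenGen T G))
    (b : ExteriorAlgebra ℂ (OddGen T G)) : mk (a + a') b = mk a b + mk a' b :=
  TensorProduct.add_tmul a a' b

lemma mk_add_right (a : SymmetricAlgebra ℂ (EvenGen T G))
    (b b' : ExteriorAlgebra ℂ (OddGen T G)) : mk a (b + b') = mk a b + mk a b' :=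
  TensorProduct.tmul_add a b b'

lemma mk_algebraMap_left (c : ℂ) :
    mk (algebraMap ℂ (SymmetricAlgebra ℂ (EvenGen T G)) c) 1 = algebraMap ℂ (FibreAlg T G) c :=
  rfl

lemma mk_algebraMap_right (c : ℂ) :
    mk 1 (algebraMap ℂ (ExteriorAlgebra ℂ (OddGen T G)) c) = algebraMap ℂ (FibreAlg T G) c := by
  rw [← mk_algebraMap_left, mk, mk, Algebra.algebraMap_eq_smul_one, Algebra.algebraMap_eq_smul_one,
    TensorProduct.smul_tmul]

end FibreAlg

open FibreAlg

lemma formGen_eq_mk (α : T →L[ℂ] ℂ) :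
    formGen G α = mk 1 (ExteriorAlgebra.ι ℂ ((α, 0) : OddGen T G)) :=
  rfl

lemma symGen_eq_mk (α : T →L[ℂ] ℂ) :
    symGen G α = mk (SymmetricAlgebra.ι ℂ (EvenGen T G) (α, 0)) 1 :=
  rfl

/-- The vector `γ` is left unspecified because the operators below see only the component in the
dual of `T`, which is zero. The generator has degree `-(k+1)`, so odd `k` means an even generator.
-/
lemma exists_wGen_eq_mk_of_odd {k : Fin r} (hk : Odd (k : ℕ)) (β : G k →L[ℂ] ℂ) :
    ∃ γ, wGen T k β = mk (SymmetricAlgebra.ι ℂ (EvenGen T G) (0, γ)) 1 :=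
  ⟨_, dif_pos hk⟩

lemma exists_wGen_eq_mk_of_even {k : Fin r} (hk : Even (k : ℕ)) (β : G k →L[ℂ] ℂ) :
    ∃ γ, wGen T k β = mk 1 (ExteriorAlgebra.ι ℂ ((0, γ) : OddGen T G)) :=
  ⟨_, dif_neg (Nat.not_odd_iff_even.2 hk)⟩

variable (T G) in
/-- The parity automorphism: `1` on elements of even total degree and `-1` on odd ones. -/
def parity : FibreAlg T G →ₐ[ℂ] FibreAlg T G :=
  (Algebra.TensorProduct.map (AlgHom.id ℂ (SymmetricAlgebra ℂ (EvenGen T G)))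
    (CliffordAlgebra.involute (Q := (0 : QuadraticForm ℂ (OddGen T G)))) :
    SymmetricAlgebra ℂ (EvenGen T G) ⊗[ℂ] ExteriorAlgebra ℂ (OddGen T G) →ₐ[ℂ]
      SymmetricAlgebra ℂ (EvenGen T G) ⊗[ℂ] ExteriorAlgebra ℂ (OddGen T G))

lemma parity_mk (a : SymmetricAlgebra ℂ (EvenGen T G)) (b : ExteriorAlgebra ℂ (OddGen T G)) :
    parity T G (mk a b) =
      mk a (CliffordAlgebra.involute (Q := (0 : QuadraticForm ℂ (OddGen T G))) b) :=
  rfl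

lemma involute_exterior_ι {V : Type*} [AddCommGroup V] [Module ℂ V] (v : V) :
    CliffordAlgebra.involute (Q := (0 : QuadraticForm ℂ V)) (ExteriorAlgebra.ι ℂ v) =
      -ExteriorAlgebra.ι ℂ v :=
  CliffordAlgebra.involute_ι v

lemma parity_parity (a : FibreAlg T G) : parity T G (parity T G a) = a := by
  induction a using FibreAlg.induction with
  | mk a b => simp only [parity_mk, CliffordAlgebra.involute_involute]
  | add a b ha hb => simp only [map_add, ha, hb]

lemma parity_formGen (α : T →L[ℂ] ℂ) : parity T G (formGen G α) = -formGen G α := by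
  rw [formGen_eq_mk, parity_mk, involute_exterior_ι, mk_neg_right]

lemma parity_symGen (α : T →L[ℂ] ℂ) : parity T G (symGen G α) = symGen G α := by
  rw [symGen_eq_mk, parity_mk, map_one]

lemma parity_wGen (k : Fin r) (β : G k →L[ℂ] ℂ) :
    parity T G (wGen T k β) = (-1 : ℂ) ^ ((k : ℕ) + 1) • wGen T k β := by
  rcases Nat.even_or_odd (k : ℕ) with hk | hk
  · obtain ⟨γ, hγ⟩ := exists_wGen_eq_mk_of_even (T := T) hk β
    rw [hγ, parity_mk, involute_exterior_ι, mk_neg_right, hk.add_one.neg_one_pow, neg_smul, one_smul]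
  · obtain ⟨γ, hγ⟩ := exists_wGen_eq_mk_of_odd (T := T) hk β
    rw [hγ, parity_mk, map_one, hk.add_one.neg_one_pow, one_smul]

/-- Evaluation at `v` of the first component. -/
def evalFst (X : Type*) [AddCommGroup X] [Module ℂ X] (v : T) : (T →L[ℂ] ℂ) × X →ₗ[ℂ] ℂ where
  toFun p := p.1 v
  map_add' _ _ := rfl
  map_smul' _ _ := rfl

/-- The even derivation with `symGen α ↦ α v` that kills the other generators. -/
def symContract (v : T) : FibreAlg T G →ₗ[ℂ] FibreAlg T G :=
  (LinearMap.rTensor (ExteriorAlgebra ℂ (OddGen T G))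
    (symDer (V := EvenGen T G) (evalFst _ v)) :
    SymmetricAlgebra ℂ (EvenGen T G) ⊗[ℂ] ExteriorAlgebra ℂ (OddGen T G) →ₗ[ℂ]
      SymmetricAlgebra ℂ (EvenGen T G) ⊗[ℂ] ExteriorAlgebra ℂ (OddGen T G))

/-- The odd derivation with `formGen α ↦ α v` that kills the other generators. -/
def formContract (v : T) : FibreAlg T G →ₗ[ℂ] FibreAlg T G :=
  (LinearMap.lTensor (SymmetricAlgebra ℂ (EvenGen T G))
    (CliffordAlgebra.contractLeft (Q := (0 : QuadraticForm ℂ (OddGen T G))) (evalFst _ v)) :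
    SymmetricAlgebra ℂ (EvenGen T G) ⊗[ℂ] ExteriorAlgebra ℂ (OddGen T G) →ₗ[ℂ]
      SymmetricAlgebra ℂ (EvenGen T G) ⊗[ℂ] ExteriorAlgebra ℂ (OddGen T G))

lemma symContract_mk (v : T) (a : SymmetricAlgebra ℂ (EvenGen T G))
    (b : ExteriorAlgebra ℂ (OddGen T G)) :
    symContract v (mk a b) = mk (symDer (evalFst _ v) a) b :=
  rfl

lemma formContract_mk (v : T) (a : SymmetricAlgebra ℂ (EvenGen T G))
    (b : ExteriorAlgebra ℂ (OddGen T G)) :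
    formContract v (mk a b) = mk a
      (CliffordAlgebra.contractLeft (Q := (0 : QuadraticForm ℂ (OddGen T G))) (evalFst _ v) b) :=
  rfl

lemma symContract_mul (v : T) (a b : FibreAlg T G) :
    symContract v (a * b) = symContract v a * b + a * symContract v b := by
  induction a using FibreAlg.induction with
  | add a a' ha ha' => simp only [add_mul, map_add, ha, ha']; abel
  | mk a a' =>
    induction b using FibreAlg.induction with
    | add b b' hb hb' => simp only [mul_add, map_add, hb, hb']; abel
    | mk b b' => simp only [mk_mul_mk, symContract_mk, symDer_mul, mk_add_left]

lemma formContract_mul (v : T) (a b : FibreAlg T G) :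
    formContract v (a * b) = formContract v a * b + parity T G a * formContract v b := by
  induction a using FibreAlg.induction with
  | add a a' ha ha' => simp only [add_mul, map_add, ha, ha']; abel
  | mk a a' =>
    induction b using FibreAlg.induction with
    | add b b' hb hb' => simp only [mul_add, map_add, hb, hb']; abel
    | mk b b' =>
      simp only [mk_mul_mk, formContract_mk, parity_mk, exterior_contract_mul, mk_add_right]

lemma contractLeft_exterior_ι {V : Type*} [AddCommGroup V] [Module ℂ V] (f : Module.Dual ℂ V)
    (v : V) : CliffordAlgebra.contractLeft (Q := (0 : QuadraticForm ℂ V)) f (ExteriorAlgebra.ι ℂ v) =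
      algebraMap ℂ _ (f v) :=
  CliffordAlgebra.contractLeft_ι _ f v

lemma symContract_algebraMap (v : T) (c : ℂ) :
    symContract v (algebraMap ℂ (FibreAlg T G) c) = 0 := by
  rw [Algebra.algebraMap_eq_smul_one, map_smul, ← mk_one_one, symContract_mk, symDer_one,
    mk_zero_left, smul_zero]

lemma symContract_symGen (v : T) (α : T →L[ℂ] ℂ) :
    symContract v (symGen G α) = algebraMap ℂ _ (α v) := by
  rw [symGen_eq_mk, symContract_mk, symDer_ι, mk_algebraMap_left]
  rfl

lemma symContract_formGen (v : T) (α : T →L[ℂ] ℂ) : symContract v (formGen G α) = 0 := by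
  rw [formGen_eq_mk, symContract_mk, symDer_one, mk_zero_left]

lemma symContract_wGen (v : T) (k : Fin r) (β : G k →L[ℂ] ℂ) :
    symContract v (wGen T k β) = 0 := by
  rcases Nat.even_or_odd (k : ℕ) with hk | hk
  · obtain ⟨γ, hγ⟩ := exists_wGen_eq_mk_of_even (T := T) hk β
    rw [hγ, symContract_mk, symDer_one, mk_zero_left]
  · obtain ⟨γ, hγ⟩ := exists_wGen_eq_mk_of_odd (T := T) hk β
    rw [hγ, symContract_mk, symDer_ι]
    -- `evalFst` reads only the first component of `(0, γ)`.
    erw [map_zero]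
    rw [mk_zero_left]

lemma formContract_algebraMap (v : T) (c : ℂ) :
    formContract v (algebraMap ℂ (FibreAlg T G) c) = 0 := by
  rw [← mk_algebraMap_left, formContract_mk, CliffordAlgebra.contractLeft_one, mk_zero_right]

lemma formContract_symGen (v : T) (α : T →L[ℂ] ℂ) : formContract v (symGen G α) = 0 := by
  rw [symGen_eq_mk, formContract_mk, CliffordAlgebra.contractLeft_one, mk_zero_right]

lemma formContract_formGen (v : T) (α : T →L[ℂ] ℂ) :
    formContract v (formGen G α) = algebraMap ℂ _ (α v) := by
  rw [formGen_eq_mk, formContract_mk, contractLeft_exterior_ι, mk_algebraMap_right]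
  rfl

lemma formContract_wGen (v : T) (k : Fin r) (β : G k →L[ℂ] ℂ) :
    formContract v (wGen T k β) = 0 := by
  rcases Nat.even_or_odd (k : ℕ) with hk | hk
  · obtain ⟨γ, hγ⟩ := exists_wGen_eq_mk_of_even (T := T) hk β
    rw [hγ, formContract_mk, contractLeft_exterior_ι]
    erw [map_zero]
    rw [mk_zero_right]
  · obtain ⟨γ, hγ⟩ := exists_wGen_eq_mk_of_odd (T := T) hk β
    rw [hγ, formContract_mk, CliffordAlgebra.contractLeft_one, mk_zero_right]

lemma symContract_parity (v : T) (a : FibreAlg T G) :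
    symContract v (parity T G a) = parity T G (symContract v a) := by
  induction a using FibreAlg.induction with
  | add a b ha hb => simp only [map_add, ha, hb]
  | mk a b => simp only [parity_mk, symContract_mk]

lemma formGen_mul (α : T →L[ℂ] ℂ) (a : FibreAlg T G) :
    formGen G α * a = parity T G a * formGen G α := by
  induction a using FibreAlg.induction with
  | add a b ha hb => simp only [map_add, mul_add, add_mul, ha, hb]
  | mk a b =>
    simp only [formGen_eq_mk, parity_mk, mk_mul_mk, one_mul, mul_one]
    rw [exterior_ι_mul]

lemma symGen_mul (α : T →L[ℂ] ℂ) (a : FibreAlg T G) :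
    symGen G α * a = a * symGen G α := by
  induction a using FibreAlg.induction with
  | add a b ha hb => simp only [mul_add, add_mul, ha, hb]
  | mk a b => simp only [symGen_eq_mk, mk_mul_mk, one_mul, mul_one, mul_comm]

lemma formGen_add (α β : T →L[ℂ] ℂ) : formGen G (α + β) = formGen G α + formGen G β := by
  simp only [formGen_eq_mk, ← mk_add_right, ← map_add, Prod.mk_add_mk, add_zero]

lemma formGen_smul (c : ℂ) (α : T →L[ℂ] ℂ) : formGen G (c • α) = c • formGen G α := by
  have h (α : T →L[ℂ] ℂ) : formGen G α =
      mk 1 (ExteriorAlgebra.ι ℂ (LinearMap.inl ℂ _ _ α : OddGen T G)) := rfl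
  rw [h, h, map_smul, map_smul]
  exact TensorProduct.tmul_smul c _ _

lemma symGen_add (α β : T →L[ℂ] ℂ) : symGen G (α + β) = symGen G α + symGen G β := by
  simp only [symGen_eq_mk, ← mk_add_left, ← map_add, Prod.mk_add_mk, add_zero]

lemma symGen_smul (c : ℂ) (α : T →L[ℂ] ℂ) : symGen G (c • α) = c • symGen G α := by
  have h (α : T →L[ℂ] ℂ) : symGen G α =
      mk (SymmetricAlgebra.ι ℂ (EvenGen T G) (LinearMap.inl ℂ _ _ α)) 1 := rfl
  rw [h, h, map_smul, map_smul]
  exact TensorProduct.smul_tmul' c _ _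

variable (T G) in
/-- `symGen` as a linear map. -/
def symGenHom : (T →L[ℂ] ℂ) →ₗ[ℂ] FibreAlg T G where
  toFun := symGen G
  map_add' := symGen_add
  map_smul' := symGen_smul

variable (T G) in
/-- `formGen` as a linear map. -/
def formGenHom : (T →L[ℂ] ℂ) →ₗ[ℂ] FibreAlg T G where
  toFun := formGen G
  map_add' := formGen_add
  map_smul' := formGen_smul

/-! ### Koszul differentials and the Euler operator on a fibre -/

/-- `e` and `z` are dual bases of `T` and of its dual. -/
def IsDualFrame {ι : Type*} [Fintype ι] (e : ι → T) (z : ι → T →L[ℂ] ℂ) : Prop :=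
  ∀ α : T →L[ℂ] ℂ, ∑ i, α (e i) • z i = α

variable {ι : Type*} [Fintype ι] (e : ι → T) (z : ι → T →L[ℂ] ℂ)

/-- The Koszul differential `∑ zᵢ ∂/∂yᵢ`: the odd derivation with `symGen α ↦ formGen α`. -/
def koszul : FibreAlg T G →ₗ[ℂ] FibreAlg T G :=
  ∑ i, LinearMap.mulLeft ℂ (formGen G (z i)) ∘ₗ symContract (e i)

/-- The adjoint Koszul differential `∑ yᵢ ∂/∂zᵢ`: the odd derivation with
`formGen α ↦ symGen α`. -/
def coKoszul : FibreAlg T G →ₗ[ℂ] FibreAlg T G :=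
  ∑ i, LinearMap.mulLeft ℂ (symGen G (z i)) ∘ₗ formContract (e i)

/-- The Euler operator `∑ yᵢ ∂/∂yᵢ`. -/
def symEuler : FibreAlg T G →ₗ[ℂ] FibreAlg T G :=
  ∑ i, LinearMap.mulLeft ℂ (symGen G (z i)) ∘ₗ symContract (e i)

lemma koszul_apply (a : FibreAlg T G) :
    koszul e z a = ∑ i, formGen G (z i) * symContract (e i) a := by
  simp [koszul]

lemma coKoszul_apply (a : FibreAlg T G) :
    coKoszul e z a = ∑ i, symGen G (z i) * formContract (e i) a := by
  simp [coKoszul]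

lemma symEuler_apply (a : FibreAlg T G) :
    symEuler e z a = ∑ i, symGen G (z i) * symContract (e i) a := by
  simp [symEuler]

/-- An odd element times an even derivation is an odd derivation; the sign appears when the form is
moved past `a`. No duality between `e` and `z` is needed. -/
lemma koszul_mul (a b : FibreAlg T G) :
    koszul e z (a * b) = koszul e z a * b + parity T G a * koszul e z b := by
  simp only [koszul_apply, symContract_mul, Finset.sum_mul, Finset.mul_sum,
    ← Finset.sum_add_distrib]
  refine Finset.sum_congr rfl fun i _ ↦ ?_
  rw [mul_add, ← mul_assoc, ← mul_assoc, ← mul_assoc, formGen_mul (z i) a]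

lemma coKoszul_mul (a b : FibreAlg T G) :
    coKoszul e z (a * b) = coKoszul e z a * b + parity T G a * coKoszul e z b := by
  simp only [coKoszul_apply, formContract_mul, Finset.sum_mul, Finset.mul_sum,
    ← Finset.sum_add_distrib]
  refine Finset.sum_congr rfl fun i _ ↦ ?_
  rw [mul_add, ← mul_assoc, ← mul_assoc, ← mul_assoc, symGen_mul (z i) (parity T G a)]

lemma symEuler_mul (a b : FibreAlg T G) :
    symEuler e z (a * b) = symEuler e z a * b + a * symEuler e z b := by
  simp only [symEuler_apply, symContract_mul, Finset.sum_mul, Finset.mul_sum,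
    ← Finset.sum_add_distrib]
  refine Finset.sum_congr rfl fun i _ ↦ ?_
  rw [mul_add, ← mul_assoc, ← mul_assoc, ← mul_assoc, symGen_mul (z i) a]

lemma koszul_parity (a : FibreAlg T G) :
    koszul e z (parity T G a) = -parity T G (koszul e z a) := by
  simp only [koszul_apply, map_sum, map_mul, parity_formGen, symContract_parity, neg_mul,
    Finset.sum_neg_distrib, neg_neg]

lemma formContract_parity (v : T) (a : FibreAlg T G) :
    formContract v (parity T G a) = -parity T G (formContract v a) := by
  induction a using FibreAlg.induction with
  | add a b ha hb => simp only [map_add, ha, hb, neg_add]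
  | mk a b =>
    simp only [parity_mk, formContract_mk, exterior_contract_involute, mk_neg_right]

lemma coKoszul_parity (a : FibreAlg T G) :
    coKoszul e z (parity T G a) = -parity T G (coKoszul e z a) := by
  simp only [coKoszul_apply, map_sum, map_mul, parity_symGen, formContract_parity, mul_neg,
    Finset.sum_neg_distrib]

lemma koszul_algebraMap (c : ℂ) : koszul e z (algebraMap ℂ (FibreAlg T G) c) = 0 := by
  simp [koszul_apply, symContract_algebraMap]

lemma coKoszul_algebraMap (c : ℂ) : coKoszul e z (algebraMap ℂ (FibreAlg T G) c) = 0 := by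
  simp [coKoszul_apply, formContract_algebraMap]

lemma symEuler_algebraMap (c : ℂ) : symEuler e z (algebraMap ℂ (FibreAlg T G) c) = 0 := by
  simp [symEuler_apply, symContract_algebraMap]

lemma koszul_formGen (α : T →L[ℂ] ℂ) : koszul e z (formGen G α) = 0 := by
  simp [koszul_apply, symContract_formGen]

lemma symEuler_formGen (α : T →L[ℂ] ℂ) : symEuler e z (formGen G α) = 0 := by
  simp [symEuler_apply, symContract_formGen]

lemma coKoszul_symGen (α : T →L[ℂ] ℂ) : coKoszul e z (symGen G α) = 0 := by
  simp [coKoszul_apply, formContract_symGen]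

lemma koszul_wGen (k : Fin r) (β : G k →L[ℂ] ℂ) : koszul e z (wGen T k β) = 0 := by
  simp [koszul_apply, symContract_wGen]

lemma coKoszul_wGen (k : Fin r) (β : G k →L[ℂ] ℂ) : coKoszul e z (wGen T k β) = 0 := by
  simp [coKoszul_apply, formContract_wGen]

lemma symEuler_wGen (k : Fin r) (β : G k →L[ℂ] ℂ) : symEuler e z (wGen T k β) = 0 := by
  simp [symEuler_apply, symContract_wGen]

variable {e z}

lemma sum_smul_symGen (h : IsDualFrame e z) (α : T →L[ℂ] ℂ) :
    ∑ i, α (e i) • symGen G (z i) = symGen G α := by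
  conv_rhs => rw [← h α]
  exact ((map_sum (symGenHom T G) _ _).trans
    (Finset.sum_congr rfl fun i _ ↦ map_smul (symGenHom T G) _ _)).symm

lemma sum_smul_formGen (h : IsDualFrame e z) (α : T →L[ℂ] ℂ) :
    ∑ i, α (e i) • formGen G (z i) = formGen G α := by
  conv_rhs => rw [← h α]
  exact ((map_sum (formGenHom T G) _ _).trans
    (Finset.sum_congr rfl fun i _ ↦ map_smul (formGenHom T G) _ _)).symm

/-- Duality removes the frame from the value on generators, so by the Leibniz rule the operator
itself does not depend on the frame. -/
lemma koszul_symGen (h : IsDualFrame e z) (α : T →L[ℂ] ℂ) :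
    koszul e z (symGen G α) = formGen G α := by
  rw [koszul_apply, ← sum_smul_formGen h α]
  simp only [symContract_symGen, Algebra.algebraMap_eq_smul_one, mul_smul_comm, mul_one]

lemma symEuler_symGen (h : IsDualFrame e z) (α : T →L[ℂ] ℂ) :
    symEuler e z (symGen G α) = symGen G α := by
  rw [symEuler_apply, ← sum_smul_symGen h α]
  simp only [symContract_symGen, Algebra.algebraMap_eq_smul_one, mul_smul_comm, mul_one,
    sum_smul_symGen h]

lemma coKoszul_formGen (h : IsDualFrame e z) (α : T →L[ℂ] ℂ) :
    coKoszul e z (formGen G α) = symGen G α := by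
  rw [coKoszul_apply, ← sum_smul_symGen h α]
  simp only [formContract_formGen, Algebra.algebraMap_eq_smul_one, mul_smul_comm, mul_one]

variable (e z) in
/-- The anticommutator of the two Koszul differentials. -/
def koszulLaplacian : FibreAlg T G →ₗ[ℂ] FibreAlg T G :=
  koszul e z ∘ₗ coKoszul e z + coKoszul e z ∘ₗ koszul e z

-- The anticommutator of two odd derivations is an even derivation: both anticommute with parity, so
-- the cross terms cancel.
variable (e z) in
lemma koszulLaplacian_mul (a b : FibreAlg T G) :
    koszulLaplacian e z (a * b) = koszulLaplacian e z a * b + a * koszulLaplacian e z b := by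
  simp only [koszulLaplacian, LinearMap.add_apply, LinearMap.comp_apply, coKoszul_mul, koszul_mul,
    map_add, koszul_parity, coKoszul_parity, parity_parity, add_mul, mul_add, neg_mul]
  abel

end FibreOperators

/-! ### Fibrewise operators on holomorphic polynomials -/

section SectionOperators

variable {E : Type*} [NormedAddCommGroup E] [NormedSpace ℂ E]
  {M : Type*} [TopologicalSpace M] [ChartedSpace E M] [IsManifold 𝓘(ℂ, E) ω M]
  {r : ℕ} {F : Fin r → Type*} [∀ k, NormedAddCommGroup (F k)] [∀ k, NormedSpace ℂ (F k)]
  {𝔤 : Fin r → M → Type*} [∀ k, TopologicalSpace (TotalSpace (F k) (𝔤 k))]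
  [∀ k x, AddCommGroup (𝔤 k x)] [∀ k x, Module ℂ (𝔤 k x)] [∀ k x, TopologicalSpace (𝔤 k x)]
  [∀ k x, IsTopologicalAddGroup (𝔤 k x)] [∀ k x, ContinuousSMul ℂ (𝔤 k x)]
  [∀ k, FiberBundle (F k) (𝔤 k)] [∀ k, VectorBundle ℂ (F k) (𝔤 k)]

/-- Fibrewise application of a family of linear maps to sections. -/
def secOp (f : ∀ x : M, AlgAt E 𝔤 x →ₗ[ℂ] AlgAt E 𝔤 x) (U : Opens M) :
    Sec E 𝔤 U →ₗ[ℂ] Sec E 𝔤 U where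
  toFun s x := f x (s x)
  map_add' s t := funext fun x ↦ map_add (f x) (s x) (t x)
  map_smul' c s := funext fun x ↦ map_smul (f x) c (s x)

lemma resSec_secOp (f : ∀ x : M, AlgAt E 𝔤 x →ₗ[ℂ] AlgAt E 𝔤 x) {U V : Opens M} (h : V ≤ U)
    (s : Sec E 𝔤 U) : resSec E 𝔤 h (secOp f U s) = secOp f V (resSec E 𝔤 h s) :=
  rfl

/-- A function as a section of the bundle of algebras. -/
def secFn (V : Opens M) (f : M → ℂ) : Sec E 𝔤 V :=
  fun x ↦ algebraMap ℂ (AlgAt E 𝔤 (x : M)) (f x)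

/-- A one-form as a section of the bundle of algebras, in form degree one. -/
def secForm (V : Opens M) (α : ∀ x : M, TangentSpace 𝓘(ℂ, E) x →L[ℂ] ℂ) : Sec E 𝔤 V :=
  fun x ↦ formGen _ (α x)

/-- A one-form as a section of the bundle of algebras, as a symmetric generator. -/
def secSym (V : Opens M) (α : ∀ x : M, TangentSpace 𝓘(ℂ, E) x →L[ℂ] ℂ) : Sec E 𝔤 V :=
  fun x ↦ symGen _ (α x)

/-- A section of the dual of `𝔤 k` as a section of the bundle of algebras. -/
def secW (V : Opens M) (k : Fin r) (β : ∀ x : M, 𝔤 k x →L[ℂ] ℂ) : Sec E 𝔤 V :=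
  fun x ↦ wGen (G := fun k ↦ 𝔤 k x) _ k (β x)

lemma HolPoly.smul {V : Opens M} {m : Deg} {s : Sec E 𝔤 V} (c : ℂ)
    (hs : HolPoly E F 𝔤 V m s) : HolPoly E F 𝔤 V m (c • s) := by
  have h := HolPoly.mul 0 m _ s
    (HolPoly.fn (E := E) (F := F) (𝔤 := 𝔤) (V := V) (fun _ ↦ c) contMDiffOn_const) hs
  rw [zero_add] at h
  have e : c • s = secFn V (fun _ ↦ c) * s :=
    funext fun x ↦ Algebra.smul_def c (s x)
  rwa [e]

lemma IsHol.smul {U : Opens M} {m : Deg} {s : Sec E 𝔤 U} (c : ℂ)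
    (hs : IsHol E F 𝔤 U m s) : IsHol E F 𝔤 U m (c • s) := by
  intro x hx
  obtain ⟨V, hV, hxV, hp⟩ := hs x hx
  exact ⟨V, hV, hxV, hp.smul c⟩

/-- The parity automorphism on sections. -/
def secParity (U : Opens M) : Sec E 𝔤 U →ₗ[ℂ] Sec E 𝔤 U :=
  secOp (fun x ↦ (parity (TangentSpace 𝓘(ℂ, E) x) (fun k ↦ 𝔤 k x)).toLinearMap) U

lemma secParity_secFn (V : Opens M) (f : M → ℂ) :
    secParity V (secFn V f : Sec E 𝔤 V) = (-1 : ℂ) ^ 0 • secFn V f :=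
  funext fun x ↦ (AlgHom.commutes (parity _ _) (f x)).trans
    (by rw [pow_zero]; exact (one_smul ℂ _).symm)

lemma secParity_secForm (V : Opens M) (α : ∀ x : M, TangentSpace 𝓘(ℂ, E) x →L[ℂ] ℂ) :
    secParity V (secForm V α : Sec E 𝔤 V) = (-1 : ℂ) ^ 1 • secForm V α :=
  funext fun x ↦ (parity_formGen (α x)).trans
    (by rw [pow_one]; exact (neg_one_smul ℂ (formGen (fun k ↦ 𝔤 k (x : M)) (α x))).symm)

lemma secParity_secSym (V : Opens M) (α : ∀ x : M, TangentSpace 𝓘(ℂ, E) x →L[ℂ] ℂ) :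
    secParity V (secSym V α : Sec E 𝔤 V) = (-1 : ℂ) ^ 0 • secSym V α :=
  funext fun x ↦ (parity_symGen (α x)).trans
    (by rw [pow_zero]; exact (one_smul ℂ (symGen (fun k ↦ 𝔤 k (x : M)) (α x))).symm)

lemma secParity_secW (V : Opens M) (k : Fin r) (β : ∀ x : M, 𝔤 k x →L[ℂ] ℂ) :
    secParity V (secW V k β : Sec E 𝔤 V) = (-1 : ℂ) ^ ((k : ℕ) + 1) • secW V k β :=
  funext fun x ↦ parity_wGen (T := TangentSpace 𝓘(ℂ, E) (x : M)) (G := fun k ↦ 𝔤 k (x : M)) k (β x)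

/-- The sign is that of the total degree, to which `m 1` does not contribute. It follows that parity
preserves holomorphic polynomials. -/
lemma HolPoly.secParity_eq {V : Opens M} {m : Deg} {s : Sec E 𝔤 V}
    (hs : HolPoly E F 𝔤 V m s) : secParity V s = (-1 : ℂ) ^ (m 0 + m 2) • s := by
  have key (t : Sec E 𝔤 V) {a b : ℕ} (h : a = b) : (-1 : ℂ) ^ a • t = (-1 : ℂ) ^ b • t := by rw [h]
  induction hs with
  | zero m => rw [map_zero, smul_zero]
  | fn f hf => exact (secParity_secFn V f).trans (key _ (by simp))
  | form α hα => exact (secParity_secForm V α).trans (key _ (by simp))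
  | sym α hα => exact (secParity_secSym V α).trans (key _ (by simp))
  | w k β hβ => exact (secParity_secW V k β).trans (key _ (by simp))
  | add m s t _ _ hs ht => rw [map_add, hs, ht, smul_add]
  | mul m n s t _ _ hs ht =>
    have h : secParity V (s * t) = secParity V s * secParity V t :=
      funext fun x ↦ map_mul (parity _ _) (s x) (t x)
    rw [h, hs, ht, smul_mul_smul_comm, ← pow_add]
    congr 2
    simp only [Finsupp.add_apply]
    omega

lemma HolPoly.secParity {V : Opens M} {m : Deg} {s : Sec E 𝔤 V}
    (hs : HolPoly E F 𝔤 V m s) : HolPoly E F 𝔤 V m (secParity V s) := by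
  rw [hs.secParity_eq]
  exact hs.smul _

variable (F) in
/-- The value of an operator at `s` is of multidegree `m - eᵢ + d` if `s` is of multidegree `m`,
and it is zero if `m` does not involve `eᵢ`. -/
def ShiftsAt (i : Fin 3) (d : Deg) {V : Opens M} (φ : Sec E 𝔤 V →ₗ[ℂ] Sec E 𝔤 V) (m : Deg)
    (s : Sec E 𝔤 V) : Prop :=
  -- Multidegrees are natural numbers, so `m - eᵢ` makes no sense when `m i = 0`; vanishing there is
  -- recorded separately, and the induction over products uses it.
  (m i = 0 → φ s = 0) ∧ ∀ m', m' + Finsupp.single i 1 = m → HolPoly E F 𝔤 V (m' + d) (φ s)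

lemma ShiftsAt.of_eq_zero {i : Fin 3} {d : Deg} {V : Opens M} {φ : Sec E 𝔤 V →ₗ[ℂ] Sec E 𝔤 V}
    {m : Deg} {s : Sec E 𝔤 V} (h : φ s = 0) : ShiftsAt F i d φ m s :=
  ⟨fun _ ↦ h, fun _ _ ↦ h ▸ HolPoly.zero _⟩

lemma ShiftsAt.of_single {i : Fin 3} {d : Deg} {V : Opens M} {φ : Sec E 𝔤 V →ₗ[ℂ] Sec E 𝔤 V}
    {s : Sec E 𝔤 V} (h : HolPoly E F 𝔤 V d (φ s)) : ShiftsAt F i d φ (Finsupp.single i 1) s := by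
  refine ⟨fun h0 ↦ absurd h0 (by simp), fun m' hm' ↦ ?_⟩
  rw [add_eq_right.1 hm', zero_add]
  exact h

/-- An operator satisfying a twisted Leibniz rule shifts multidegrees if it does so on
generators. -/
lemma HolPoly.shiftsAt {i : Fin 3} {d : Deg} {V : Opens M} {φ : Sec E 𝔤 V →ₗ[ℂ] Sec E 𝔤 V}
    (τ : Sec E 𝔤 V → Sec E 𝔤 V)
    (hτ : ∀ m s, HolPoly E F 𝔤 V m s → HolPoly E F 𝔤 V m (τ s))
    (hmul : ∀ s t, φ (s * t) = φ s * t + τ s * φ t)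
    (hfn : ∀ f : M → ℂ, φ (secFn V f) = 0)
    (hform : ∀ α : ∀ x : M, TangentSpace 𝓘(ℂ, E) x →L[ℂ] ℂ, IsHolDual E E V α →
      ShiftsAt F i d φ (Finsupp.single 0 1) (secForm V α))
    (hsym : ∀ α : ∀ x : M, TangentSpace 𝓘(ℂ, E) x →L[ℂ] ℂ, IsHolDual E E V α →
      ShiftsAt F i d φ (Finsupp.single 1 1) (secSym V α))
    (hw : ∀ (k : Fin r) (β : ∀ x : M, 𝔤 k x →L[ℂ] ℂ),
      φ (secW V k β) = 0)
    {m : Deg} {s : Sec E 𝔤 V} (hs : HolPoly E F 𝔤 V m s) : ShiftsAt F i d φ m s := by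
  induction hs with
  | zero m => exact .of_eq_zero (map_zero _)
  | fn f hf => exact .of_eq_zero (hfn f)
  | form α hα => exact hform α hα
  | sym α hα => exact hsym α hα
  | w k β hβ => exact .of_eq_zero (hw k β)
  | add m s t _ _ ihs iht =>
    refine ⟨fun h ↦ by rw [map_add, ihs.1 h, iht.1 h, add_zero], fun m' hm' ↦ ?_⟩
    rw [map_add]
    exact .add _ _ _ (ihs.2 m' hm') (iht.2 m' hm')
  | mul m n s t hs ht ihs iht =>
    refine ⟨fun h ↦ ?_, fun m' hm' ↦ ?_⟩
    · rw [Finsupp.add_apply, Nat.add_eq_zero_iff] at h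
      rw [hmul, ihs.1 h.1, iht.1 h.2, zero_mul, mul_zero, add_zero]
    · rw [hmul]
      have key (p : Deg) (hp : p i ≠ 0) : p - Finsupp.single i 1 + Finsupp.single i 1 = p :=
        tsub_add_cancel_of_le (by simpa [Nat.one_le_iff_ne_zero] using hp)
      refine .add _ _ _ ?_ ?_
      -- In each Leibniz term only the factor being differentiated loses an `eᵢ`; if it has none,
      -- the term is zero.
      · by_cases h : m i = 0
        · rw [ihs.1 h, zero_mul]
          exact .zero _
        · have h1 := HolPoly.mul _ _ _ _ (ihs.2 _ (key m h)) ht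
          have h2 : m - Finsupp.single i 1 + n = m' := by
            apply add_right_cancel (b := Finsupp.single i 1)
            rw [hm', add_right_comm, key m h]
          rwa [add_right_comm, h2] at h1
      · by_cases h : n i = 0
        · rw [iht.1 h, mul_zero]
          exact .zero _
        · have h1 := HolPoly.mul _ _ _ _ (hτ m s hs) (iht.2 _ (key n h))
          have h2 : m + (n - Finsupp.single i 1) = m' := by
            apply add_right_cancel (b := Finsupp.single i 1)
            rw [hm', add_assoc, key n h]
          rwa [← add_assoc, h2] at h1

/-- An operator that acts as a derivation multiplies by a linear function of the multidegree if it
does so on generators. -/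
lemma HolPoly.eigen {V : Opens M} {φ : Sec E 𝔤 V →ₗ[ℂ] Sec E 𝔤 V} (c : Deg →+ ℂ)
    (hmul : ∀ s t, φ (s * t) = φ s * t + s * φ t)
    (hfn : ∀ f : M → ℂ, φ (secFn V f) = 0)
    (hform : ∀ α : ∀ x : M, TangentSpace 𝓘(ℂ, E) x →L[ℂ] ℂ,
      φ (secForm V α) = c (Finsupp.single 0 1) • secForm V α)
    (hsym : ∀ α : ∀ x : M, TangentSpace 𝓘(ℂ, E) x →L[ℂ] ℂ,
      φ (secSym V α) = c (Finsupp.single 1 1) • secSym V α)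
    (hw : ∀ (k : Fin r) (β : ∀ x : M, 𝔤 k x →L[ℂ] ℂ),
      φ (secW V k β) = 0)
    (hc : ∀ n, c (Finsupp.single 2 n) = 0)
    {m : Deg} {s : Sec E 𝔤 V} (hs : HolPoly E F 𝔤 V m s) : φ s = c m • s := by
  induction hs with
  | zero m => rw [map_zero, smul_zero]
  | fn f hf =>
    rw [map_zero]
    exact (hfn f).trans (zero_smul ℂ _).symm
  | form α hα => exact hform α
  | sym α hα => exact hsym α
  | w k β hβ =>
    rw [hc]
    exact (hw k β).trans (zero_smul ℂ _).symm
  | add m s t _ _ ihs iht => rw [map_add, ihs, iht, smul_add]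
  | mul m n s t _ _ ihs iht =>
    rw [hmul, ihs, iht, map_add, add_smul, smul_mul_assoc, mul_smul_comm]

end SectionOperators

/-! ### Contractions and Koszul operators on sections -/

section KoszulSections

variable {E : Type*} [NormedAddCommGroup E] [NormedSpace ℂ E]
  {M : Type*} [TopologicalSpace M] [ChartedSpace E M] [IsManifold 𝓘(ℂ, E) ω M]
  {r : ℕ} {F : Fin r → Type*} [∀ k, NormedAddCommGroup (F k)] [∀ k, NormedSpace ℂ (F k)]
  {𝔤 : Fin r → M → Type*} [∀ k, TopologicalSpace (TotalSpace (F k) (𝔤 k))]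
  [∀ k x, AddCommGroup (𝔤 k x)] [∀ k x, Module ℂ (𝔤 k x)] [∀ k x, TopologicalSpace (𝔤 k x)]
  [∀ k x, IsTopologicalAddGroup (𝔤 k x)] [∀ k x, ContinuousSMul ℂ (𝔤 k x)]
  [∀ k, FiberBundle (F k) (𝔤 k)] [∀ k, VectorBundle ℂ (F k) (𝔤 k)]

/-- The contraction of symmetric generators with a vector field, on sections. -/
def secContract (v : ∀ x : M, TangentSpace 𝓘(ℂ, E) x) (U : Opens M) :
    Sec E 𝔤 U →ₗ[ℂ] Sec E 𝔤 U :=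
  secOp (fun x ↦ symContract (G := fun k ↦ 𝔤 k x) (v x)) U

lemma secContract_mul (v : ∀ x : M, TangentSpace 𝓘(ℂ, E) x) {U : Opens M} (s t : Sec E 𝔤 U) :
    secContract v U (s * t) = secContract v U s * t + s * secContract v U t :=
  funext fun x ↦ symContract_mul (v x) (s x) (t x)

/-- Holomorphy of `v` enters only through its pairings with holomorphic one-forms, which are the
values of the contraction on generators. -/
lemma HolPoly.contract {V : Opens M} {v : ∀ x : M, TangentSpace 𝓘(ℂ, E) x}
    (hv : ∀ α : ∀ x : M, TangentSpace 𝓘(ℂ, E) x →L[ℂ] ℂ, IsHolDual E E V α →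
      ContMDiffOn 𝓘(ℂ, E) 𝓘(ℂ, ℂ) ω (fun x ↦ α x (v x)) V)
    {m : Deg} {s : Sec E 𝔤 V} (hs : HolPoly E F 𝔤 V m s) :
    ShiftsAt F 1 0 (secContract v V) m s := by
  refine hs.shiftsAt id (fun _ _ h ↦ h) (secContract_mul v) ?_ ?_ ?_ ?_
  · exact fun f ↦ funext fun x ↦ symContract_algebraMap (v x) (f x)
  · exact fun α _ ↦ .of_eq_zero (funext fun x ↦ symContract_formGen (v x) (α x))
  · intro α hα
    refine .of_single ?_
    have h : secContract v V (secSym V α : Sec E 𝔤 V) = secFn V (fun x ↦ α x (v x)) :=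
      funext fun x ↦ symContract_symGen (v x) (α x)
    rw [h]
    exact HolPoly.fn _ (hv α hα)
  · exact fun k β ↦ funext fun x ↦ symContract_wGen (G := fun k ↦ 𝔤 k (x : M)) (v x) k (β x)

/-- The Euler operator `∑ yᵢ ∂/∂yᵢ` on sections. -/
def secEuler {ι : Type*} [Fintype ι] (e : ι → ∀ x : M, TangentSpace 𝓘(ℂ, E) x)
    (z : ι → ∀ x : M, TangentSpace 𝓘(ℂ, E) x →L[ℂ] ℂ) (U : Opens M) :
    Sec E 𝔤 U →ₗ[ℂ] Sec E 𝔤 U :=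
  secOp (fun x ↦ symEuler (G := fun k ↦ 𝔤 k x) (fun i ↦ e i x) (fun i ↦ z i x)) U

lemma secEuler_eq_sum {ι : Type*} [Fintype ι] (e : ι → ∀ x : M, TangentSpace 𝓘(ℂ, E) x)
    (z : ι → ∀ x : M, TangentSpace 𝓘(ℂ, E) x →L[ℂ] ℂ) {U : Opens M} (s : Sec E 𝔤 U) :
    secEuler e z U s = ∑ i, secSym U (z i) * secContract (e i) U s := by
  refine funext fun x ↦ (symEuler_apply _ _ (s x)).trans ?_
  exact (Finset.sum_apply x Finset.univ
    (fun i ↦ (secSym U (z i) * secContract (e i) U s : Sec E 𝔤 U))).symm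

/-- An even derivation that fixes the symmetric generators from `Ω_M` and kills the other generators
counts the former. -/
lemma HolPoly.euler {V : Opens M} {ι : Type*} [Fintype ι]
    {e : ι → ∀ x : M, TangentSpace 𝓘(ℂ, E) x}
    {z : ι → ∀ x : M, TangentSpace 𝓘(ℂ, E) x →L[ℂ] ℂ}
    (h : ∀ x ∈ V, IsDualFrame (fun i ↦ e i x) (fun i ↦ z i x))
    {m : Deg} {s : Sec E 𝔤 V} (hs : HolPoly E F 𝔤 V m s) :
    secEuler e z V s = (m 1 : ℂ) • s := by
  refine hs.eigen ((Nat.castAddMonoidHom ℂ).comp (Finsupp.applyAddHom 1)) ?_ ?_ ?_ ?_ ?_ ?_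
  · exact fun s t ↦ funext fun x ↦ symEuler_mul _ _ (s x) (t x)
  · exact fun f ↦ funext fun x ↦ symEuler_algebraMap _ _ (f x)
  · intro α
    have h0 : secEuler e z V (secForm V α : Sec E 𝔤 V) = 0 :=
      funext fun x ↦ symEuler_formGen _ _ (α x)
    simp [h0]
  · intro α
    have h0 : secEuler e z V (secSym V α : Sec E 𝔤 V) = secSym V α :=
      funext fun x ↦ symEuler_symGen (h x x.2) (α x)
    simp [h0]
  · exact fun k β ↦ funext fun x ↦ symEuler_wGen (G := fun k ↦ 𝔤 k (x : M)) _ _ k (β x)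
  · simp

/-! ### Koszul operators from a pointwise frame -/

section GlobalFrame

variable [FiniteDimensional ℂ E]

/-- A (discontinuous) frame of the tangent spaces. -/
def baseVec (i : Fin (Module.finrank ℂ E)) (x : M) : TangentSpace 𝓘(ℂ, E) x :=
  Module.finBasis ℂ E i

/-- The dual of `baseVec`. -/
def baseCovec (i : Fin (Module.finrank ℂ E)) (x : M) : TangentSpace 𝓘(ℂ, E) x →L[ℂ] ℂ :=
  (LinearMap.toContinuousLinearMap ((Module.finBasis ℂ E).coord i) : E →L[ℂ] ℂ)

lemma IsDualFrame.of_basis {T : Type*} [AddCommGroup T] [Module ℂ T] [TopologicalSpace T]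
    [IsTopologicalAddGroup T] [ContinuousSMul ℂ T] {ι : Type*} [Fintype ι] (b : Module.Basis ι ℂ T)
    {z : ι → T →L[ℂ] ℂ} (hz : ∀ i v, z i v = b.repr v i) : IsDualFrame b z := by
  intro α
  refine ContinuousLinearMap.ext fun v ↦ ?_
  conv_rhs => rw [← b.sum_repr v, map_sum]
  simp only [_root_.sum_apply, _root_.smul_apply, hz, map_smul,
    smul_eq_mul, mul_comm]

lemma isDualFrame_base (x : M) :
    IsDualFrame (fun i ↦ baseVec (E := E) i x) (fun i ↦ baseCovec i x) :=
  let b : Module.Basis (Fin (Module.finrank ℂ E)) ℂ (TangentSpace 𝓘(ℂ, E) x) :=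
    Module.finBasis ℂ E
  .of_basis b fun _ _ ↦ rfl

/-- The Koszul differential on sections: the odd derivation sending a one-form as a symmetric
generator to the same one-form as a differential form. -/
def secKoszul (U : Opens M) : Sec E 𝔤 U →ₗ[ℂ] Sec E 𝔤 U :=
  secOp (fun x ↦ koszul (G := fun k ↦ 𝔤 k x) (fun i ↦ baseVec i x) (fun i ↦ baseCovec i x)) U

/-- The adjoint Koszul differential on sections: the odd derivation sending a differential form of
degree one to the same one-form as a symmetric generator. -/
def secCoKoszul (U : Opens M) : Sec E 𝔤 U →ₗ[ℂ] Sec E 𝔤 U :=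
  secOp (fun x ↦ coKoszul (G := fun k ↦ 𝔤 k x) (fun i ↦ baseVec i x) (fun i ↦ baseCovec i x)) U

lemma secKoszul_mul {U : Opens M} (s t : Sec E 𝔤 U) :
    secKoszul U (s * t) = secKoszul U s * t + secParity U s * secKoszul U t :=
  funext fun x ↦ koszul_mul _ _ (s x) (t x)

lemma secCoKoszul_mul {U : Opens M} (s t : Sec E 𝔤 U) :
    secCoKoszul U (s * t) = secCoKoszul U s * t + secParity U s * secCoKoszul U t :=
  funext fun x ↦ coKoszul_mul _ _ (s x) (t x)

lemma secKoszul_secSym {U : Opens M} (α : ∀ x : M, TangentSpace 𝓘(ℂ, E) x →L[ℂ] ℂ) :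
    secKoszul U (secSym U α : Sec E 𝔤 U) = secForm U α :=
  funext fun x ↦ koszul_symGen (isDualFrame_base (x : M)) (α x)

lemma secCoKoszul_secForm {U : Opens M} (α : ∀ x : M, TangentSpace 𝓘(ℂ, E) x →L[ℂ] ℂ) :
    secCoKoszul U (secForm U α : Sec E 𝔤 U) = secSym U α :=
  funext fun x ↦ coKoszul_formGen (isDualFrame_base (x : M)) (α x)

lemma secKoszul_secForm {U : Opens M} (α : ∀ x : M, TangentSpace 𝓘(ℂ, E) x →L[ℂ] ℂ) :
    secKoszul U (secForm U α : Sec E 𝔤 U) = 0 :=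
  funext fun x ↦ koszul_formGen _ _ (α x)

lemma secCoKoszul_secSym {U : Opens M} (α : ∀ x : M, TangentSpace 𝓘(ℂ, E) x →L[ℂ] ℂ) :
    secCoKoszul U (secSym U α : Sec E 𝔤 U) = 0 :=
  funext fun x ↦ coKoszul_symGen _ _ (α x)

lemma secKoszul_secFn {U : Opens M} (f : M → ℂ) : secKoszul U (secFn U f : Sec E 𝔤 U) = 0 :=
  funext fun x ↦ koszul_algebraMap _ _ (f x)

lemma secCoKoszul_secFn {U : Opens M} (f : M → ℂ) : secCoKoszul U (secFn U f : Sec E 𝔤 U) = 0 :=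
  funext fun x ↦ coKoszul_algebraMap _ _ (f x)

lemma secKoszul_secW {U : Opens M} (k : Fin r) (β : ∀ x : M, 𝔤 k x →L[ℂ] ℂ) :
    secKoszul U (secW U k β : Sec E 𝔤 U) = 0 :=
  funext fun x ↦ koszul_wGen (G := fun k ↦ 𝔤 k (x : M)) _ _ k (β x)

lemma secCoKoszul_secW {U : Opens M} (k : Fin r) (β : ∀ x : M, 𝔤 k x →L[ℂ] ℂ) :
    secCoKoszul U (secW U k β : Sec E 𝔤 U) = 0 :=
  funext fun x ↦ coKoszul_wGen (G := fun k ↦ 𝔤 k (x : M)) _ _ k (β x)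

/-- Although `baseVec` need not vary continuously, the operator takes each generator to a generator
or to zero, so holomorphy survives by the Leibniz rule. -/
lemma HolPoly.koszul {V : Opens M} {m : Deg} {s : Sec E 𝔤 V} (hs : HolPoly E F 𝔤 V m s) :
    ShiftsAt F 1 (Finsupp.single 0 1) (secKoszul V) m s := by
  refine hs.shiftsAt (LInfty.secParity V) (fun _ _ h ↦ h.secParity) secKoszul_mul secKoszul_secFn
    (fun α _ ↦ .of_eq_zero (secKoszul_secForm α)) (fun α hα ↦ .of_single ?_) secKoszul_secW
  rw [secKoszul_secSym]
  exact HolPoly.form α hα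

lemma HolPoly.coKoszul {V : Opens M} {m : Deg} {s : Sec E 𝔤 V} (hs : HolPoly E F 𝔤 V m s) :
    ShiftsAt F 0 (Finsupp.single 1 1) (secCoKoszul V) m s := by
  refine hs.shiftsAt (LInfty.secParity V) (fun _ _ h ↦ h.secParity) secCoKoszul_mul
    secCoKoszul_secFn (fun α hα ↦ .of_single ?_) (fun α _ ↦ .of_eq_zero (secCoKoszul_secSym α))
    secCoKoszul_secW
  rw [secCoKoszul_secForm]
  exact HolPoly.sym α hα

/-- The left side is an even derivation. A one-form, of either kind, returns to itself after a round
trip, and the generators from `𝒲` are killed, so the derivation counts the one-forms of both kinds.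
-/
lemma HolPoly.laplacian {V : Opens M} {m : Deg} {s : Sec E 𝔤 V} (hs : HolPoly E F 𝔤 V m s) :
    secKoszul V (secCoKoszul V s) + secCoKoszul V (secKoszul V s) = ((m 0 + m 1 : ℕ) : ℂ) • s := by
  refine hs.eigen (φ := secKoszul V ∘ₗ secCoKoszul V + secCoKoszul V ∘ₗ secKoszul V)
    ((Nat.castAddMonoidHom ℂ).comp (Finsupp.applyAddHom 0 + Finsupp.applyAddHom 1)) ?_ ?_ ?_ ?_ ?_ ?_
  · exact fun s t ↦ funext fun x ↦ koszulLaplacian_mul _ _ (s x) (t x)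
  · intro f
    simp [secKoszul_secFn, secCoKoszul_secFn]
  · intro α
    simp [secCoKoszul_secForm, secKoszul_secForm, secKoszul_secSym]
  · intro α
    simp [secCoKoszul_secSym, secKoszul_secSym, secCoKoszul_secForm]
  · intro k β
    simp [secKoszul_secW, secCoKoszul_secW]
  · simp

end GlobalFrame

/-! ### Holomorphic local frames -/

section LocalFrame

variable [FiniteDimensional ℂ E]

variable (E) in
/-- The domain of the local frame of the tangent bundle around a point. -/
def frameDomain (x₀ : M) : Opens M :=
  ⟨(trivializationAt E (TangentSpace 𝓘(ℂ, E) : M → Type _) x₀).baseSet,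
    (trivializationAt E (TangentSpace 𝓘(ℂ, E) : M → Type _) x₀).open_baseSet⟩

variable (E) in
/-- A holomorphic local frame of the tangent bundle around a point. -/
def frameVec (x₀ : M) (i : Fin (Module.finrank ℂ E)) (x : M) : TangentSpace 𝓘(ℂ, E) x :=
  (trivializationAt E (TangentSpace 𝓘(ℂ, E) : M → Type _) x₀).localFrame (Module.finBasis ℂ E) i x

variable (E) in
/-- The dual frame of the cotangent bundle. -/
def frameCovec (x₀ : M) (i : Fin (Module.finrank ℂ E)) (x : M) :
    TangentSpace 𝓘(ℂ, E) x →L[ℂ] ℂ :=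
  (LinearMap.toContinuousLinearMap ((Module.finBasis ℂ E).coord i) : E →L[ℂ] ℂ).comp
    ((trivializationAt E (TangentSpace 𝓘(ℂ, E) : M → Type _) x₀).continuousLinearMapAt ℂ x)

lemma mem_frameDomain (x₀ : M) : x₀ ∈ frameDomain E x₀ :=
  mem_baseSet_trivializationAt E (TangentSpace 𝓘(ℂ, E) : M → Type _) x₀

lemma isDualFrame_frame {x₀ x : M} (hx : x ∈ frameDomain E x₀) :
    IsDualFrame (fun i ↦ frameVec E x₀ i x) (fun i ↦ frameCovec E x₀ i x) := by
  set t := trivializationAt E (TangentSpace 𝓘(ℂ, E) : M → Type _) x₀ with ht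
  have hx' : x ∈ t.baseSet := hx
  have h : (fun i ↦ frameVec E x₀ i x) = t.basisAt (Module.finBasis ℂ E) hx' :=
    funext fun i ↦ t.localFrame_apply_of_mem_baseSet (Module.finBasis ℂ E) hx'
  rw [h]
  refine .of_basis _ fun i v ↦ ?_
  change (Module.finBasis ℂ E).repr (t.continuousLinearMapAt ℂ x v) i = _
  simp [Trivialization.basisAt, hx']

/-- In the trivialization of the cotangent bundle induced by that of the tangent bundle, the section
is a constant coordinate functional. -/
lemma isHolDual_frameCovec (x₀ : M) (i : Fin (Module.finrank ℂ E)) :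
    IsHolDual E E (frameDomain E x₀) (frameCovec E x₀ i) := by
  set t := trivializationAt E (TangentSpace 𝓘(ℂ, E) : M → Type _) x₀ with ht
  set t' := trivializationAt ℂ (Bundle.Trivial M ℂ) x₀ with ht'
  have h := (Trivialization.continuousLinearMap (RingHom.id ℂ) t t').contMDiffOn_section_baseSet_iff
    (n := ω) (IB := 𝓘(ℂ, E)) (s := fun x ↦ frameCovec E x₀ i x)
  have hb : (Trivialization.continuousLinearMap (RingHom.id ℂ) t t').baseSet = t.baseSet :=
    Set.inter_univ _
  rw [hb] at h
  refine h.2 (ContMDiffOn.congr (contMDiffOn_const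
    (c := (LinearMap.toContinuousLinearMap ((Module.finBasis ℂ E).coord i) : E →L[ℂ] ℂ)))
    fun x hx ↦ ?_)
  refine ContinuousLinearMap.ext fun v ↦ ?_
  refine Eq.trans ?_
    (congrArg ((Module.finBasis ℂ E).coord i) (t.continuousLinearMapAt_symmL (R := ℂ) hx v))
  rw [Trivialization.continuousLinearMap_apply]
  change t'.continuousLinearMapAt ℂ x (frameCovec E x₀ i x (t.symmL ℂ x v)) = _
  have ht'' : t' = Bundle.Trivial.trivialization M ℂ := Bundle.Trivial.eq_trivialization M ℂ t'
  rw [Trivialization.continuousLinearMapAt_apply, Trivialization.coe_linearMapAt_of_mem]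
  · rw [ht'']
    rfl
  · exact Set.mem_univ x

lemma contMDiffOn_apply_frameVec {x₀ : M} (i : Fin (Module.finrank ℂ E)) {V : Opens M}
    (hV : V ≤ frameDomain E x₀) {α : ∀ x : M, TangentSpace 𝓘(ℂ, E) x →L[ℂ] ℂ}
    (hα : IsHolDual E E V α) :
    ContMDiffOn 𝓘(ℂ, E) 𝓘(ℂ, ℂ) ω (fun x ↦ α x (frameVec E x₀ i x)) V := by
  have hv : ContMDiffOn 𝓘(ℂ, E) (𝓘(ℂ, E).prod 𝓘(ℂ, E)) ω
      (fun x ↦ TotalSpace.mk' E x (frameVec E x₀ i x)) (frameDomain E x₀) :=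
    Trivialization.contMDiffOn_localFrame_baseSet _ _ _ _
  have h := ContMDiffOn.clm_bundle_apply (E₂ := Bundle.Trivial M ℂ) (b := fun x ↦ x) hα
    (hv.mono hV)
  intro x hx
  exact (Bundle.contMDiffWithinAt_totalSpace.1 (h x hx)).2

end LocalFrame

end KoszulSections

/-! ### Operators on formal series -/

section SeriesOperators

variable {E : Type*} [NormedAddCommGroup E] [NormedSpace ℂ E]
  {M : Type*} [TopologicalSpace M] [ChartedSpace E M] [IsManifold 𝓘(ℂ, E) ω M]
  {r : ℕ} {F : Fin r → Type*} [∀ k, NormedAddCommGroup (F k)] [∀ k, NormedSpace ℂ (F k)]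
  {𝔤 : Fin r → M → Type*} [∀ k, TopologicalSpace (TotalSpace (F k) (𝔤 k))]
  [∀ k x, AddCommGroup (𝔤 k x)] [∀ k x, Module ℂ (𝔤 k x)] [∀ k x, TopologicalSpace (𝔤 k x)]
  [∀ k x, IsTopologicalAddGroup (𝔤 k x)] [∀ k x, ContinuousSMul ℂ (𝔤 k x)]
  [∀ k, FiberBundle (F k) (𝔤 k)] [∀ k, VectorBundle ℂ (F k) (𝔤 k)]

lemma sec_ext_local {U : Opens M} {s t : Sec E 𝔤 U}
    (h : ∀ x ∈ U, ∃ (V : Opens M) (hV : V ≤ U), x ∈ V ∧ resSec E 𝔤 hV s = resSec E 𝔤 hV t) :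
    s = t := by
  refine funext fun x ↦ ?_
  obtain ⟨V, hV, hx, hst⟩ := h x x.2
  exact congrFun hst ⟨x, hx⟩

lemma IsHol.secOp_shift {f : ∀ x : M, AlgAt E 𝔤 x →ₗ[ℂ] AlgAt E 𝔤 x} {U : Opens M} {i : Fin 3}
    {d : Deg} (h : ∀ V ≤ U, ∀ m s, HolPoly E F 𝔤 V m s → ShiftsAt F i d (secOp f V) m s)
    {m : Deg} {s : Sec E 𝔤 U} (hs : IsHol E F 𝔤 U (m + Finsupp.single i 1) s) :
    IsHol E F 𝔤 U (m + d) (secOp f U s) := by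
  intro x hx
  obtain ⟨V, hV, hxV, hp⟩ := hs x hx
  exact ⟨V, hV, hxV, (h V hV _ _ hp).2 m rfl⟩

lemma IsHol.secOp_eq_zero {f : ∀ x : M, AlgAt E 𝔤 x →ₗ[ℂ] AlgAt E 𝔤 x} {U : Opens M} {i : Fin 3}
    {d : Deg} (h : ∀ V ≤ U, ∀ m s, HolPoly E F 𝔤 V m s → ShiftsAt F i d (secOp f V) m s)
    {m : Deg} (hm : m i = 0) {s : Sec E 𝔤 U} (hs : IsHol E F 𝔤 U m s) : secOp f U s = 0 := by
  refine sec_ext_local fun x hx ↦ ?_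
  obtain ⟨V, hV, hxV, hp⟩ := hs x hx
  exact ⟨V, hV, hxV, (h V hV _ _ hp).1 hm⟩

/-- The component of multidegree `m`. -/
def cf {U : Opens M} (m : Deg) : CEAlg E F 𝔤 U →ₗ[ℂ] Sec E 𝔤 U where
  toFun a := MvPowerSeries.coeff m a.1
  map_add' _ _ := rfl
  map_smul' _ _ := rfl

lemma ext_cf {U : Opens M} {a b : CEAlg E F 𝔤 U} (h : ∀ m, cf m a = cf m b) : a = b :=
  Subtype.ext (MvPowerSeries.ext h)

lemma isHol_cf {U : Opens M} (m : Deg) (a : CEAlg E F 𝔤 U) : IsHol E F 𝔤 U m (cf m a) :=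
  a.2 m

lemma cf_res {U V : Opens M} (h : V ≤ U) (m : Deg) (a : CEAlg E F 𝔤 U) :
    cf m (res E F 𝔤 h a) = resSec E 𝔤 h (cf m a) :=
  MvPowerSeries.coeff_map (resSec E 𝔤 h : _ →ₐ[ℂ] _).toRingHom m a.1

lemma cf_trunc_of_pos {U : Opens M} {S : Deg → Prop} {m : Deg} (h : S m) (a : CEAlg E F 𝔤 U) :
    cf m (trunc E F 𝔤 S a) = cf m a :=
  coeff_truncFun_of_pos E 𝔤 h a.1

lemma cf_trunc_of_neg {U : Opens M} {S : Deg → Prop} {m : Deg} (h : ¬ S m)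
    (a : CEAlg E F 𝔤 U) : cf m (trunc E F 𝔤 S a) = 0 :=
  coeff_truncFun_of_neg E 𝔤 h a.1

lemma mem_supp_iff {U : Opens M} {S : Deg → Prop} {a : CEAlg E F 𝔤 U} :
    a ∈ supp E F 𝔤 U S ↔ ∀ m, ¬ S m → cf m a = 0 :=
  Iff.rfl

/-- This reduces filtration estimates to small open sets, where the tangent bundle has a holomorphic
frame. -/
lemma mem_supp_of_local {U : Opens M} {S : Deg → Prop} {a : CEAlg E F 𝔤 U}
    (h : ∀ x ∈ U, ∃ (V : Opens M) (hV : V ≤ U), x ∈ V ∧ res E F 𝔤 hV a ∈ supp E F 𝔤 V S) :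
    a ∈ supp E F 𝔤 U S := by
  refine mem_supp_iff.2 fun m hm ↦ sec_ext_local fun x hx ↦ ?_
  obtain ⟨V, hV, hxV, ha⟩ := h x hx
  exact ⟨V, hV, hxV, by rw [← cf_res, mem_supp_iff.1 ha m hm, map_zero]⟩

/-- The operator on series with components `c m • f (a_{src m})`. -/
def shiftOp (f : ∀ x : M, AlgAt E 𝔤 x →ₗ[ℂ] AlgAt E 𝔤 x) (U : Opens M) (src : Deg → Deg)
    -- Holomorphy is required only where `c m ≠ 0`: elsewhere `src m` may come from a truncated
    -- subtraction and be meaningless.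
    (c : Deg → ℂ) (H : ∀ m (s : Sec E 𝔤 U), c m ≠ 0 → IsHol E F 𝔤 U (src m) s →
      IsHol E F 𝔤 U m (secOp f U s)) :
    CEAlg E F 𝔤 U →ₗ[ℂ] CEAlg E F 𝔤 U where
  toFun a := ⟨fun m ↦ c m • secOp f U (cf (src m) a), fun m ↦ by
    change IsHol E F 𝔤 U m (c m • secOp f U (cf (src m) a))
    by_cases h : c m = 0
    · rw [h, zero_smul]
      exact IsHol.zero U m
    · exact (H m _ h (isHol_cf _ a)).smul _⟩
  map_add' a b := ext_cf fun m ↦ by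
    change c m • secOp f U (cf (src m) (a + b)) =
      c m • secOp f U (cf (src m) a) + c m • secOp f U (cf (src m) b)
    rw [map_add, map_add, smul_add]
  map_smul' z a := ext_cf fun m ↦ by
    change c m • secOp f U (cf (src m) (z • a)) = z • c m • secOp f U (cf (src m) a)
    rw [map_smul, map_smul, smul_comm]

lemma cf_shiftOp {f : ∀ x : M, AlgAt E 𝔤 x →ₗ[ℂ] AlgAt E 𝔤 x} {U : Opens M} {src : Deg → Deg}
    {c : Deg → ℂ} {H : ∀ m (s : Sec E 𝔤 U), c m ≠ 0 → IsHol E F 𝔤 U (src m) s →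
      IsHol E F 𝔤 U m (secOp f U s)} (m : Deg) (a : CEAlg E F 𝔤 U) :
    cf m (shiftOp f U src c H a) = c m • secOp f U (cf (src m) a) :=
  rfl

lemma res_shiftOp {f : ∀ x : M, AlgAt E 𝔤 x →ₗ[ℂ] AlgAt E 𝔤 x} {U V : Opens M} (h : V ≤ U)
    {src : Deg → Deg} {c : Deg → ℂ}
    {HU : ∀ m (s : Sec E 𝔤 U), c m ≠ 0 → IsHol E F 𝔤 U (src m) s →
      IsHol E F 𝔤 U m (secOp f U s)}
    {HV : ∀ m (s : Sec E 𝔤 V), c m ≠ 0 → IsHol E F 𝔤 V (src m) s →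
      IsHol E F 𝔤 V m (secOp f V s)} (a : CEAlg E F 𝔤 U) :
    shiftOp f V src c HV (res E F 𝔤 h a) = res E F 𝔤 h (shiftOp f U src c HU a) := by
  refine ext_cf fun m ↦ ?_
  rw [cf_res, cf_shiftOp, cf_shiftOp, cf_res, map_smul, resSec_secOp]

variable (F) in
/-- A holomorphic one-form as a symmetric generator. -/
def symEl {U : Opens M} {α : ∀ x : M, TangentSpace 𝓘(ℂ, E) x →L[ℂ] ℂ} (hα : IsHolDual E E U α) :
    CEAlg E F 𝔤 U :=
  ⟨MvPowerSeries.monomial (Finsupp.single 1 1) (secSym U α), fun m ↦ by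
    classical
    rw [MvPowerSeries.coeff_monomial]
    split_ifs with h
    · subst h
      exact fun x hx ↦ ⟨U, le_rfl, hx, HolPoly.sym α hα⟩
    · exact IsHol.zero U m⟩

variable (F) in
/-- A holomorphic one-form as a differential form. -/
def formEl {U : Opens M} {α : ∀ x : M, TangentSpace 𝓘(ℂ, E) x →L[ℂ] ℂ} (hα : IsHolDual E E U α) :
    CEAlg E F 𝔤 U :=
  ⟨MvPowerSeries.monomial (Finsupp.single 0 1) (secForm U α), fun m ↦ by
    classical
    rw [MvPowerSeries.coeff_monomial]
    split_ifs with h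
    · subst h
      exact fun x hx ↦ ⟨U, le_rfl, hx, HolPoly.form α hα⟩
    · exact IsHol.zero U m⟩

lemma cf_add_symEl_mul {U : Opens M} {α : ∀ x : M, TangentSpace 𝓘(ℂ, E) x →L[ℂ] ℂ}
    (hα : IsHolDual E E U α) (m : Deg) (a : CEAlg E F 𝔤 U) :
    cf (m + Finsupp.single 1 1) (symEl F hα * a) = secSym U α * cf m a := by
  rw [add_comm]
  exact MvPowerSeries.coeff_add_monomial_mul _ _ _ _

lemma cf_symEl_mul_of_eq_zero {U : Opens M} {α : ∀ x : M, TangentSpace 𝓘(ℂ, E) x →L[ℂ] ℂ}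
    (hα : IsHolDual E E U α) {m : Deg} (hm : m 1 = 0) (a : CEAlg E F 𝔤 U) :
    cf m (symEl F hα * a) = 0 := by
  refine (MvPowerSeries.coeff_monomial_mul _ _ _ _).trans (if_neg fun h ↦ ?_)
  have := h 1
  simp [hm] at this

lemma cf_add_formEl_mul {U : Opens M} {α : ∀ x : M, TangentSpace 𝓘(ℂ, E) x →L[ℂ] ℂ}
    (hα : IsHolDual E E U α) (m : Deg) (a : CEAlg E F 𝔤 U) :
    cf (m + Finsupp.single 0 1) (formEl F hα * a) = secForm U α * cf m a := by
  rw [add_comm]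
  exact MvPowerSeries.coeff_add_monomial_mul _ _ _ _

lemma cf_formEl_mul_of_eq_zero {U : Opens M} {α : ∀ x : M, TangentSpace 𝓘(ℂ, E) x →L[ℂ] ℂ}
    (hα : IsHolDual E E U α) {m : Deg} (hm : m 0 = 0) (a : CEAlg E F 𝔤 U) :
    cf m (formEl F hα * a) = 0 := by
  refine (MvPowerSeries.coeff_monomial_mul _ _ _ _).trans (if_neg fun h ↦ ?_)
  have := h 0
  simp [hm] at this

lemma cf_formEl_self {U : Opens M} {α : ∀ x : M, TangentSpace 𝓘(ℂ, E) x →L[ℂ] ℂ}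
    (hα : IsHolDual E E U α) :
    cf (Finsupp.single 0 1) (formEl F hα : CEAlg E F 𝔤 U) = secForm U α :=
  MvPowerSeries.coeff_monomial_same _ _

lemma cf_formEl_of_ne {U : Opens M} {α : ∀ x : M, TangentSpace 𝓘(ℂ, E) x →L[ℂ] ℂ}
    (hα : IsHolDual E E U α) {m : Deg} (hm : m ≠ Finsupp.single 0 1) :
    cf m (formEl F hα : CEAlg E F 𝔤 U) = 0 :=
  MvPowerSeries.coeff_monomial_ne hm _

lemma symEl_mem_supp {U : Opens M} {α : ∀ x : M, TangentSpace 𝓘(ℂ, E) x →L[ℂ] ℂ}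
    (hα : IsHolDual E E U α) {S : Deg → Prop} (hS : S (Finsupp.single 1 1)) :
    (symEl F hα : CEAlg E F 𝔤 U) ∈ supp E F 𝔤 U S :=
  fun m hm ↦ MvPowerSeries.coeff_monomial_ne (fun h ↦ hm (by rwa [h])) _

/-- The filtration by the number of symmetric generators from `Ω_M`. -/
abbrev symFilt (n : ℕ) (m : Deg) : Prop := n ≤ m 1

lemma mul_mem_symFilt {U : Opens M} {k n : ℕ} {a b : CEAlg E F 𝔤 U}
    (ha : a ∈ supp E F 𝔤 U (symFilt k)) (hb : b ∈ supp E F 𝔤 U (symFilt n)) :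
    a * b ∈ supp E F 𝔤 U (symFilt (k + n)) := by
  classical
  intro m hm
  refine (MvPowerSeries.coeff_mul _ _ _).trans (Finset.sum_eq_zero fun p hp ↦ ?_)
  rw [Finset.HasAntidiagonal.mem_antidiagonal] at hp
  have h : p.1 1 + p.2 1 = m 1 := by rw [← hp]; rfl
  by_cases h1 : symFilt k p.1
  · rw [hb p.2 (by unfold symFilt at *; omega), mul_zero]
  · rw [ha p.1 h1, zero_mul]

lemma mem_symFilt_zero {U : Opens M} (a : CEAlg E F 𝔤 U) : a ∈ supp E F 𝔤 U (symFilt 0) :=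
  fun _ hm ↦ absurd (Nat.zero_le _) hm

/-! ### The Koszul differential and its contracting homotopy -/

variable [FiniteDimensional ℂ E]

variable (E F 𝔤) in
/-- The Koszul differential on `Ω_M^* ⊗ C^*𝔤`. -/
def kosz (U : Opens M) : CEAlg E F 𝔤 U →ₗ[ℂ] CEAlg E F 𝔤 U :=
  shiftOp (fun x ↦ koszul (G := fun k ↦ 𝔤 k x) (fun i ↦ baseVec i x) (fun i ↦ baseCovec i x)) U
    -- The source has one form fewer and one symmetric generator more. The weight vanishes at `m 0 =
    -- 0`, where the subtraction truncates.
    (fun m ↦ m - Finsupp.single 0 1 + Finsupp.single 1 1) (fun m ↦ if m 0 = 0 then 0 else 1)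
    (fun m s hc hs ↦ by
      have h : m - Finsupp.single 0 1 + Finsupp.single 0 1 = m :=
        tsub_add_cancel_of_le (by
          rw [Finsupp.single_le_iff]
          exact Nat.one_le_iff_ne_zero.2 (fun h ↦ hc (if_pos h)))
      have := hs.secOp_shift (fun V _ _ _ h ↦ h.koszul)
      rwa [h] at this)

variable (E F 𝔤) in
/-- The contracting homotopy for the Koszul differential. -/
def koszHomotopy (U : Opens M) : CEAlg E F 𝔤 U →ₗ[ℂ] CEAlg E F 𝔤 U :=
  shiftOp (fun x ↦ coKoszul (G := fun k ↦ 𝔤 k x) (fun i ↦ baseVec i x) (fun i ↦ baseCovec i x)) U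
    (fun m ↦ m - Finsupp.single 1 1 + Finsupp.single 0 1)
    -- The weight inverts the eigenvalue `m 0 + m 1` of the Laplacian, a number that both Koszul
    -- operators preserve.
    (fun m ↦ if m 1 = 0 then 0 else ((m 0 + m 1 : ℕ) : ℂ)⁻¹)
    (fun m s hc hs ↦ by
      have h : m - Finsupp.single 1 1 + Finsupp.single 1 1 = m :=
        tsub_add_cancel_of_le (by
          rw [Finsupp.single_le_iff]
          exact Nat.one_le_iff_ne_zero.2 (fun h ↦ hc (if_pos h)))
      have := hs.secOp_shift (fun V _ _ _ h ↦ h.coKoszul)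
      rwa [h] at this)

lemma res_koszHomotopy {U V : Opens M} (h : V ≤ U) (a : CEAlg E F 𝔤 U) :
    koszHomotopy E F 𝔤 V (res E F 𝔤 h a) = res E F 𝔤 h (koszHomotopy E F 𝔤 U a) :=
  res_shiftOp h a

lemma res_kosz {U V : Opens M} (h : V ≤ U) (a : CEAlg E F 𝔤 U) :
    kosz E F 𝔤 V (res E F 𝔤 h a) = res E F 𝔤 h (kosz E F 𝔤 U a) :=
  res_shiftOp h a

lemma cf_add_kosz {U : Opens M} (m : Deg) (a : CEAlg E F 𝔤 U) :
    cf (m + Finsupp.single 0 1) (kosz E F 𝔤 U a) =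
      secKoszul U (cf (m + Finsupp.single 1 1) a) := by
  refine (cf_shiftOp _ _).trans ?_
  rw [if_neg (by simp), one_smul, add_tsub_cancel_right]
  rfl

lemma cf_kosz_of_eq_zero {U : Opens M} {m : Deg} (hm : m 0 = 0) (a : CEAlg E F 𝔤 U) :
    cf m (kosz E F 𝔤 U a) = 0 := by
  refine (cf_shiftOp _ _).trans ?_
  rw [if_pos hm, zero_smul]

lemma cf_add_koszHomotopy {U : Opens M} (m : Deg) (a : CEAlg E F 𝔤 U) :
    cf (m + Finsupp.single 1 1) (koszHomotopy E F 𝔤 U a) =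
      ((m 0 + m 1 + 1 : ℕ) : ℂ)⁻¹ • secCoKoszul U (cf (m + Finsupp.single 0 1) a) := by
  refine (cf_shiftOp _ _).trans ?_
  rw [if_neg (by simp), add_tsub_cancel_right]
  simp only [Finsupp.add_apply, Finsupp.single_eq_same, ne_eq, zero_ne_one, not_false_eq_true,
    Finsupp.single_eq_of_ne, add_zero, add_assoc]
  rfl

lemma cf_koszHomotopy_of_eq_zero {U : Opens M} {m : Deg} (hm : m 1 = 0) (a : CEAlg E F 𝔤 U) :
    cf m (koszHomotopy E F 𝔤 U a) = 0 := by
  refine (cf_shiftOp _ _).trans ?_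
  rw [if_pos hm, zero_smul]

lemma secKoszul_cf_eq_zero {U : Opens M} {m : Deg} (hm : m 1 = 0) (a : CEAlg E F 𝔤 U) :
    secKoszul U (cf m a) = 0 :=
  (isHol_cf m a).secOp_eq_zero (fun _ _ _ _ h ↦ h.koszul) hm

lemma secCoKoszul_cf_eq_zero {U : Opens M} {m : Deg} (hm : m 0 = 0) (a : CEAlg E F 𝔤 U) :
    secCoKoszul U (cf m a) = 0 :=
  (isHol_cf m a).secOp_eq_zero (fun _ _ _ _ h ↦ h.coKoszul) hm

lemma exists_eq_add_single {m : Deg} {i : Fin 3} (h : m i ≠ 0) :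
    ∃ m', m = m' + Finsupp.single i 1 :=
  ⟨m - Finsupp.single i 1, (tsub_add_cancel_of_le (by
    rw [Finsupp.single_le_iff]
    exact Nat.one_le_iff_ne_zero.2 h)).symm⟩

lemma laplacian_cf {U : Opens M} (m : Deg) (a : CEAlg E F 𝔤 U) :
    secKoszul U (secCoKoszul U (cf m a)) + secCoKoszul U (secKoszul U (cf m a)) =
      ((m 0 + m 1 : ℕ) : ℂ) • cf m a := by
  refine sec_ext_local fun x hx ↦ ?_
  obtain ⟨V, hV, hxV, hp⟩ := isHol_cf m a x hx
  exact ⟨V, hV, hxV, hp.laplacian⟩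

/-- Both compositions carry the weight `(m 0 + m 1)⁻¹`, so their sum is the Laplacian divided by its
eigenvalue. This is the identity except where the eigenvalue is zero, that is, on `Ŝ(𝒲)`. -/
lemma kosz_koszHomotopy (U : Opens M) (a : CEAlg E F 𝔤 U) :
    kosz E F 𝔤 U (koszHomotopy E F 𝔤 U a) + koszHomotopy E F 𝔤 U (kosz E F 𝔤 U a) =
      a - trunc E F 𝔤 wOnly a := by
  refine ext_cf fun m ↦ ?_
  rw [map_add, map_sub]
  have h1 : cf m (kosz E F 𝔤 U (koszHomotopy E F 𝔤 U a)) =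
      ((m 0 + m 1 : ℕ) : ℂ)⁻¹ • secKoszul U (secCoKoszul U (cf m a)) := by
    by_cases h : m 0 = 0
    -- The zero weight at the boundary agrees with the formula, since there is no form left to
    -- convert.
    · rw [cf_kosz_of_eq_zero h, secCoKoszul_cf_eq_zero h, LinearMap.map_zero, smul_zero]
    · obtain ⟨n, rfl⟩ := exists_eq_add_single h
      rw [cf_add_kosz, cf_add_koszHomotopy, map_smul]
      simp [add_right_comm]
  have h2 : cf m (koszHomotopy E F 𝔤 U (kosz E F 𝔤 U a)) =
      ((m 0 + m 1 : ℕ) : ℂ)⁻¹ • secCoKoszul U (secKoszul U (cf m a)) := by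
    by_cases h : m 1 = 0
    · rw [cf_koszHomotopy_of_eq_zero h, secKoszul_cf_eq_zero h, LinearMap.map_zero, smul_zero]
    · obtain ⟨n, rfl⟩ := exists_eq_add_single h
      rw [cf_add_koszHomotopy, cf_add_kosz]
      simp [add_assoc]
  rw [h1, h2, ← smul_add, laplacian_cf, smul_smul]
  by_cases h : wOnly m
  -- The eigenvalue is zero, and so are both sides.
  · rw [cf_trunc_of_pos h, h.1, h.2]
    simp
  · rw [cf_trunc_of_neg h, inv_mul_cancel₀, one_smul, sub_zero]
    rw [Nat.cast_ne_zero]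
    intro h0
    exact h ⟨by omega, by omega⟩

/-- Only this case of the Leibniz rule is needed. There is no sign because the generator is even. -/
lemma kosz_symEl_mul {U : Opens M} {α : ∀ x : M, TangentSpace 𝓘(ℂ, E) x →L[ℂ] ℂ}
    (hα : IsHolDual E E U α) (a : CEAlg E F 𝔤 U) :
    kosz E F 𝔤 U (symEl F hα * a) = formEl F hα * a + symEl F hα * kosz E F 𝔤 U a := by
  refine ext_cf fun m ↦ ?_
  rw [map_add]
  by_cases h : m 0 = 0
  · rw [cf_kosz_of_eq_zero h, cf_formEl_mul_of_eq_zero hα h, zero_add]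
    by_cases h' : m 1 = 0
    · rw [cf_symEl_mul_of_eq_zero hα h']
    · obtain ⟨n, rfl⟩ := exists_eq_add_single h'
      rw [cf_add_symEl_mul, cf_kosz_of_eq_zero (by simpa using h), mul_zero]
  · obtain ⟨n, rfl⟩ := exists_eq_add_single h
    rw [cf_add_kosz, cf_add_symEl_mul, cf_add_formEl_mul, secKoszul_mul, secKoszul_secSym,
      secParity_secSym, pow_zero, one_smul]
    congr 1
    by_cases h' : n 1 = 0
    · rw [secKoszul_cf_eq_zero h', cf_symEl_mul_of_eq_zero hα (by simpa using h'), mul_zero]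
    · obtain ⟨n, rfl⟩ := exists_eq_add_single h'
      rw [add_right_comm, cf_add_symEl_mul, cf_add_kosz]

/-! ### Division by frame coordinates -/

/-- Division by the `i`-th coordinate of a local frame. -/
def frameDiv {x₀ : M} {V : Opens M} (hV : V ≤ frameDomain E x₀) (i : Fin (Module.finrank ℂ E)) :
    CEAlg E F 𝔤 V →ₗ[ℂ] CEAlg E F 𝔤 V :=
  shiftOp (fun x ↦ symContract (G := fun k ↦ 𝔤 k x) (frameVec E x₀ i x)) V
    -- The source has symmetric degree `m 1 + 1`; the weight cancels the factor produced by Euler's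
    -- identity.
    (fun m ↦ m + Finsupp.single 1 1) (fun m ↦ ((m 1 + 1 : ℕ) : ℂ)⁻¹)
    (fun m _ _ hs ↦ by
      have := hs.secOp_shift (fun W hW _ _ h ↦ h.contract (v := frameVec E x₀ i)
        (fun α hα ↦ contMDiffOn_apply_frameVec i (hW.trans hV) hα))
      rwa [add_zero] at this)

lemma frameDiv_mem {x₀ : M} {V : Opens M} (hV : V ≤ frameDomain E x₀)
    (i : Fin (Module.finrank ℂ E)) {n : ℕ} {a : CEAlg E F 𝔤 V}
    (ha : a ∈ supp E F 𝔤 V (symFilt (n + 1))) :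
    frameDiv hV i a ∈ supp E F 𝔤 V (symFilt n) := by
  refine mem_supp_iff.2 fun m hm ↦ (cf_shiftOp _ _).trans ?_
  rw [mem_supp_iff.1 ha, map_zero, smul_zero]
  simpa [symFilt] using hm

lemma isHolDual_frameCovec_of_le {x₀ : M} {V : Opens M} (hV : V ≤ frameDomain E x₀)
    (i : Fin (Module.finrank ℂ E)) : IsHolDual E E V (frameCovec E x₀ i) :=
  ContMDiffOn.mono (isHolDual_frameCovec x₀ i) hV

/-- Euler's identity, divided by the degree component by component. A whole series becomes a finite
combination of the coordinates, so the Leibniz rule applies to it directly. -/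
lemma sum_symEl_mul_frameDiv {x₀ : M} {V : Opens M} (hV : V ≤ frameDomain E x₀)
    {a : CEAlg E F 𝔤 V} (ha : a ∈ supp E F 𝔤 V (symFilt 1)) :
    ∑ i, symEl F (isHolDual_frameCovec_of_le hV i) * frameDiv hV i a = a := by
  refine ext_cf fun m ↦ ?_
  rw [map_sum]
  by_cases h : m 1 = 0
  · rw [mem_supp_iff.1 ha m (by simp [symFilt, h])]
    exact Finset.sum_eq_zero fun i _ ↦ cf_symEl_mul_of_eq_zero _ h _
  · obtain ⟨n, rfl⟩ := exists_eq_add_single h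
    have key : secEuler (frameVec E x₀) (frameCovec E x₀) V (cf (n + Finsupp.single 1 1) a) =
        ((n 1 + 1 : ℕ) : ℂ) • cf (n + Finsupp.single 1 1) a := by
      refine sec_ext_local fun x hx ↦ ?_
      obtain ⟨W, hW, hxW, hp⟩ := isHol_cf (n + Finsupp.single 1 1) a x hx
      refine ⟨W, hW, hxW, ?_⟩
      have := hp.euler (fun x hx ↦ isDualFrame_frame (hV (hW hx)))
      rw [Finsupp.add_apply, Finsupp.single_eq_same] at this
      exact this
    have h2 (i) : cf (n + Finsupp.single 1 1) (symEl F (isHolDual_frameCovec_of_le hV i) *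
        frameDiv hV i a) = ((n 1 + 1 : ℕ) : ℂ)⁻¹ • (secSym V (frameCovec E x₀ i) *
          secContract (frameVec E x₀ i) V (cf (n + Finsupp.single 1 1) a)) := by
      rw [cf_add_symEl_mul, ← mul_smul_comm]
      rfl
    rw [Finset.sum_congr rfl fun i _ ↦ h2 i, ← Finset.smul_sum, ← secEuler_eq_sum, key, smul_smul,
      inv_mul_cancel₀ (Nat.cast_ne_zero.2 (Nat.succ_ne_zero _)), one_smul]

end SeriesOperators

section Contraction

variable {E : Type*} [NormedAddCommGroup E] [NormedSpace ℂ E]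
  {M : Type*} [TopologicalSpace M] [ChartedSpace E M] [IsManifold 𝓘(ℂ, E) ω M]
  {r : ℕ} {F : Fin r → Type*} [∀ k, NormedAddCommGroup (F k)] [∀ k, NormedSpace ℂ (F k)]
  {𝔤 : Fin r → M → Type*} [∀ k, TopologicalSpace (TotalSpace (F k) (𝔤 k))]
  [∀ k x, AddCommGroup (𝔤 k x)] [∀ k x, Module ℂ (𝔤 k x)] [∀ k x, TopologicalSpace (𝔤 k x)]
  [∀ k x, IsTopologicalAddGroup (𝔤 k x)] [∀ k x, ContinuousSMul ℂ (𝔤 k x)]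
  [∀ k, FiberBundle (F k) (𝔤 k)] [∀ k, VectorBundle ℂ (F k) (𝔤 k)]

/-! ### Neumann series for the filtration -/

section Neumann

/-- The filtration is separated: step `m 1 + 1` already has no component of multidegree `m`. -/
lemma eq_zero_of_mem_symFilt {U : Opens M} {a : CEAlg E F 𝔤 U}
    (h : ∀ n, a ∈ supp E F 𝔤 U (symFilt n)) : a = 0 :=
  ext_cf fun m ↦ mem_supp_iff.1 (h (m 1 + 1)) m (Nat.not_succ_le_self _)

lemma symFilt_anti {U : Opens M} {k n : ℕ} (h : k ≤ n) {a : CEAlg E F 𝔤 U}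
    (ha : a ∈ supp E F 𝔤 U (symFilt n)) : a ∈ supp E F 𝔤 U (symFilt k) :=
  fun m hm ↦ ha m fun h' ↦ hm (h.trans h')

/-- An operator raises the filtration by the number of symmetric generators from `Ω_M`. -/
def RaisesFilt {U : Opens M} (u : CEAlg E F 𝔤 U →ₗ[ℂ] CEAlg E F 𝔤 U) : Prop :=
  ∀ n, ∀ a ∈ supp E F 𝔤 U (symFilt n), u a ∈ supp E F 𝔤 U (symFilt (n + 1))

lemma RaisesFilt.pow_mem {U : Opens M} {u : CEAlg E F 𝔤 U →ₗ[ℂ] CEAlg E F 𝔤 U}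
    (hu : RaisesFilt u) (k : ℕ) (a : CEAlg E F 𝔤 U) :
    ((-u) ^ k) a ∈ supp E F 𝔤 U (symFilt k) := by
  induction k with
  | zero => exact mem_symFilt_zero _
  | succ k ih =>
    rw [pow_succ', Module.End.mul_apply, LinearMap.neg_apply]
    exact Submodule.neg_mem _ (hu k _ ih)

/-- Partial sums of the Neumann series of `(1 + u)⁻¹`. -/
def neumannSum {U : Opens M} (u : CEAlg E F 𝔤 U →ₗ[ℂ] CEAlg E F 𝔤 U) (n : ℕ) :
    CEAlg E F 𝔤 U →ₗ[ℂ] CEAlg E F 𝔤 U :=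
  ∑ k ∈ Finset.range n, (-u) ^ k

/-- The Neumann series of `(1 + u)⁻¹`, summed componentwise. -/
def neumann {U : Opens M} (u : CEAlg E F 𝔤 U →ₗ[ℂ] CEAlg E F 𝔤 U) :
    CEAlg E F 𝔤 U →ₗ[ℂ] CEAlg E F 𝔤 U where
  -- When `u` raises the filtration, `(-u) ^ k` has no component of multidegree `m` for `k > m 1`,
  -- so `m 1 + 1` terms give the full sum.
  toFun a := ⟨fun m ↦ cf m (neumannSum u (m 1 + 1) a), fun m ↦ isHol_cf m _⟩
  map_add' a b := ext_cf fun m ↦ by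
    change cf m (neumannSum u (m 1 + 1) (a + b)) = cf m _ + cf m _
    rw [map_add, map_add]
  map_smul' c a := ext_cf fun m ↦ by
    change cf m (neumannSum u (m 1 + 1) (c • a)) = c • cf m _
    rw [map_smul, map_smul]

lemma cf_neumann {U : Opens M} (u : CEAlg E F 𝔤 U →ₗ[ℂ] CEAlg E F 𝔤 U) (m : Deg)
    (a : CEAlg E F 𝔤 U) : cf m (neumann u a) = cf m (neumannSum u (m 1 + 1) a) :=
  rfl

lemma RaisesFilt.neumann_sub_mem {U : Opens M} {u : CEAlg E F 𝔤 U →ₗ[ℂ] CEAlg E F 𝔤 U}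
    (hu : RaisesFilt u) (n : ℕ) (a : CEAlg E F 𝔤 U) :
    neumann u a - neumannSum u n a ∈ supp E F 𝔤 U (symFilt n) := by
  refine mem_supp_iff.2 fun m hm ↦ ?_
  rw [map_sub, cf_neumann, sub_eq_zero]
  have hle : m 1 + 1 ≤ n := not_le.1 hm
  induction n, hle using Nat.le_induction with
  | base => rfl
  | succ n hn ih =>
    have h : neumannSum u (n + 1) = neumannSum u n + (-u) ^ n := Finset.sum_range_succ _ _
    rw [h, LinearMap.add_apply, map_add, ← ih (not_le.2 hn),
      mem_supp_iff.1 (hu.pow_mem n a) m (not_le.2 hn), add_zero]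

/-- The difference `a - b` equals `-u (a - b)`, hence lies in every step of the filtration. -/
lemma RaisesFilt.injective {U : Opens M} {u : CEAlg E F 𝔤 U →ₗ[ℂ] CEAlg E F 𝔤 U}
    (hu : RaisesFilt u) {a b : CEAlg E F 𝔤 U} (h : a + u a = b + u b) : a = b := by
  rw [← sub_eq_zero]
  refine eq_zero_of_mem_symFilt fun n ↦ ?_
  induction n with
  | zero => exact mem_symFilt_zero _
  | succ n ih =>
    have h' : a - b = -u (a - b) := by
      rw [map_sub, neg_sub, sub_eq_sub_iff_add_eq_add, h, add_comm]
    rw [h']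
    exact Submodule.neg_mem _ (hu n _ ih)

/-- Modulo filtration `n` the series may be replaced by its `n`-th partial sum; the geometric sum
then leaves the error `(-u) ^ n a`, also of filtration `n`. -/
lemma RaisesFilt.neumann_add {U : Opens M} {u : CEAlg E F 𝔤 U →ₗ[ℂ] CEAlg E F 𝔤 U}
    (hu : RaisesFilt u) (a : CEAlg E F 𝔤 U) : neumann u a + u (neumann u a) = a := by
  rw [← sub_eq_zero]
  refine eq_zero_of_mem_symFilt fun n ↦ ?_
  have h1 : neumannSum u n a + u (neumannSum u n a) = a - ((-u) ^ n) a := by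
    have h := congrArg (fun f : Module.End ℂ (CEAlg E F 𝔤 U) ↦ f a) (mul_neg_geom_sum (-u) n)
    simp only [Module.End.mul_apply, Module.End.one_apply, LinearMap.sub_apply,
      LinearMap.neg_apply, sub_neg_eq_add] at h
    exact h
  have h2 : neumann u a + u (neumann u a) - a =
      (neumann u a - neumannSum u n a) + u (neumann u a - neumannSum u n a) - ((-u) ^ n) a := by
    rw [map_sub, ← sub_eq_zero]
    have h3 : a = neumannSum u n a + u (neumannSum u n a) + ((-u) ^ n) a := by
      rw [h1, sub_add_cancel]
    nth_rewrite 3 [h3]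
    abel
  rw [h2]
  have h3 := hu.neumann_sub_mem n a
  exact Submodule.sub_mem _ (Submodule.add_mem _ h3 (symFilt_anti n.le_succ (hu n _ h3)))
    (hu.pow_mem n a)

lemma neumann_mem_supp {U : Opens M} {u : CEAlg E F 𝔤 U →ₗ[ℂ] CEAlg E F 𝔤 U} {S : Deg → Prop}
    (hu : ∀ a ∈ supp E F 𝔤 U S, u a ∈ supp E F 𝔤 U S) {a : CEAlg E F 𝔤 U}
    (ha : a ∈ supp E F 𝔤 U S) : neumann u a ∈ supp E F 𝔤 U S := by
  have h (k : ℕ) : ((-u) ^ k) a ∈ supp E F 𝔤 U S := by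
    induction k with
    | zero => exact ha
    | succ k ih =>
      rw [pow_succ', Module.End.mul_apply, LinearMap.neg_apply]
      exact Submodule.neg_mem _ (hu _ ih)
  refine mem_supp_iff.2 fun m hm ↦ ?_
  rw [cf_neumann, neumannSum, LinearMap.sum_apply]
  exact mem_supp_iff.1 (Submodule.sum_mem _ fun k _ ↦ h k) m hm

end Neumann

/-! ### Degrees of projections and of the Koszul homotopy -/

lemma trunc_wOnly_eq_zero_iff {U : Opens M} {a : CEAlg E F 𝔤 U} :
    trunc E F 𝔤 wOnly a = 0 ↔ ∀ m, wOnly m → cf m a = 0 := by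
  refine ⟨fun h m hm ↦ ?_, fun h ↦ ext_cf fun m ↦ ?_⟩
  · rw [← cf_trunc_of_pos hm, h, map_zero]
  · by_cases hm : wOnly m
    · rw [cf_trunc_of_pos hm, h m hm, map_zero]
    · rw [cf_trunc_of_neg hm, map_zero]

lemma trunc_eq_self {U : Opens M} {S : Deg → Prop} {a : CEAlg E F 𝔤 U}
    (ha : a ∈ supp E F 𝔤 U S) : trunc E F 𝔤 S a = a := by
  refine ext_cf fun m ↦ ?_
  by_cases hm : S m
  · rw [cf_trunc_of_pos hm]
  · rw [cf_trunc_of_neg hm, mem_supp_iff.1 ha m hm]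

lemma trunc_mem {U : Opens M} (S : Deg → Prop) (a : CEAlg E F 𝔤 U) :
    trunc E F 𝔤 S a ∈ supp E F 𝔤 U S :=
  mem_supp_iff.2 fun _ hm ↦ cf_trunc_of_neg hm a

lemma trunc_res {U V : Opens M} (h : V ≤ U) (S : Deg → Prop) (a : CEAlg E F 𝔤 U) :
    trunc E F 𝔤 S (res E F 𝔤 h a) = res E F 𝔤 h (trunc E F 𝔤 S a) := by
  refine ext_cf fun m ↦ ?_
  rw [cf_res]
  by_cases hm : S m
  · rw [cf_trunc_of_pos hm, cf_trunc_of_pos hm, cf_res]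
  · rw [cf_trunc_of_neg hm, cf_trunc_of_neg hm, map_zero]

variable [FiniteDimensional ℂ E]

lemma koszHomotopy_mem_symFilt {U : Opens M} {n : ℕ} {a : CEAlg E F 𝔤 U}
    (ha : a ∈ supp E F 𝔤 U (symFilt n)) :
    koszHomotopy E F 𝔤 U a ∈ supp E F 𝔤 U (symFilt (n + 1)) := by
  refine mem_supp_iff.2 fun m hm ↦ ?_
  by_cases h : m 1 = 0
  · exact cf_koszHomotopy_of_eq_zero h a
  · obtain ⟨m, rfl⟩ := exists_eq_add_single h
    rw [cf_add_koszHomotopy, mem_supp_iff.1 ha, LinearMap.map_zero, smul_zero]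
    simpa [symFilt] using hm

lemma koszHomotopy_mem_totDeg {U : Opens M} {i j : ℤ} (hij : i + 1 = j) {a : CEAlg E F 𝔤 U}
    (ha : a ∈ supp E F 𝔤 U (totDeg j)) : koszHomotopy E F 𝔤 U a ∈ supp E F 𝔤 U (totDeg i) := by
  refine mem_supp_iff.2 fun m hm ↦ ?_
  by_cases h : m 1 = 0
  · exact cf_koszHomotopy_of_eq_zero h a
  · obtain ⟨m, rfl⟩ := exists_eq_add_single h
    rw [cf_add_koszHomotopy, mem_supp_iff.1 ha, LinearMap.map_zero, smul_zero]
    simp [totDeg] at hm ⊢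
    omega

lemma trunc_koszHomotopy {U : Opens M} (a : CEAlg E F 𝔤 U) :
    trunc E F 𝔤 wOnly (koszHomotopy E F 𝔤 U a) = 0 :=
  trunc_wOnly_eq_zero_iff.2 fun _ hm ↦ cf_koszHomotopy_of_eq_zero hm.2 a

/-! ### Behaviour of the differentials on the filtration -/

variable [∀ k, ContMDiffVectorBundle ω (F k) (𝔤 k) 𝓘(ℂ, E)]

/-- Nothing lives in positive cohomological degree, so `Q` kills the coordinates `yᵢ`. It therefore
acts on `∑ yᵢ bᵢ` through the `bᵢ`, to which induction applies. -/
lemma Q_mem_symFilt_of_le (L : LInftyStructure E F 𝔤) {x₀ : M} {V : Opens M}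
    (hV : V ≤ frameDomain E x₀) (n : ℕ) {a : CEAlg E F 𝔤 V}
    (ha : a ∈ supp E F 𝔤 V (symFilt n)) : L.Q V a ∈ supp E F 𝔤 V (symFilt n) := by
  induction n generalizing a with
  | zero => exact mem_symFilt_zero _
  | succ n ih =>
    rw [← sum_symEl_mul_frameDiv hV (symFilt_anti (Nat.succ_le_succ n.zero_le) ha), map_sum]
    refine Submodule.sum_mem _ fun i _ ↦ ?_
    have hy : (symEl F (isHolDual_frameCovec_of_le hV i) : CEAlg E F 𝔤 V) ∈
        supp E F 𝔤 V (bideg 0 0) := symEl_mem_supp _ (by simp [bideg])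
    have hQ : L.Q V (symEl F (isHolDual_frameCovec_of_le hV i)) = 0 :=
      ext_cf fun m ↦ coeff_Q_eq_zero L hy fun m' h h' ↦ by
        have := h.2.symm.trans h'.2
        omega
    rw [L.Q_mul V 0 0 _ _ hy, hQ, zero_mul, zero_add, add_zero, pow_zero, one_smul, add_comm n 1]
    exact mul_mem_symFilt (symEl_mem_supp _ (by simp [symFilt])) (ih (frameDiv_mem hV i ha))

lemma Q_mem_symFilt (L : LInftyStructure E F 𝔤) {U : Opens M} {n : ℕ} {a : CEAlg E F 𝔤 U}
    (ha : a ∈ supp E F 𝔤 U (symFilt n)) : L.Q U a ∈ supp E F 𝔤 U (symFilt n) := by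
  refine mem_supp_of_local fun x hx ↦
    ⟨U ⊓ frameDomain E x, inf_le_left, ⟨hx, mem_frameDomain x⟩, ?_⟩
  rw [← L.Q_res]
  exact Q_mem_symFilt_of_le L inf_le_right n (res_mem _ ha)

variable {L : LInftyStructure E F 𝔤} (D : GrothendieckConnection L)

/-- With no symmetric generator from `Ω_M`, form degree one and cohomological degree zero leave only
the multidegree `Finsupp.single 0 1`, where the normalisation `D_sym` prescribes `α`. -/
lemma D_symEl_sub_formEl_mem {V : Opens M} {α : ∀ x : M, TangentSpace 𝓘(ℂ, E) x →L[ℂ] ℂ}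
    (hα : IsHolDual E E V α) :
    D.D V (symEl F hα) - formEl F hα ∈ supp E F 𝔤 V (symFilt 1) := by
  refine mem_supp_iff.2 fun m hm ↦ ?_
  have hm1 : m 1 = 0 := Nat.lt_one_iff.1 (not_le.1 hm)
  rw [LinearMap.map_sub, sub_eq_zero]
  by_cases h : m = Finsupp.single 0 1
  · subst h
    rw [cf_formEl_self]
    exact D.D_sym V (symEl F hα) α hα rfl
  · rw [cf_formEl_of_ne hα h]
    refine coeff_D_eq_zero D (symEl_mem_supp (S := bideg 0 0) hα (by simp [bideg])) ?_
    intro m' h0 h2 h'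
    apply h
    have h0' := h'.1
    have h2' := h'.2
    ext j
    fin_cases j
    · simp
      omega
    · simpa using hm1
    · simp
      omega

/-- Each operator alone may lower the filtration by one. On `yᵢ b` the difference is `(D yᵢ - zᵢ) b
+ yᵢ (D b - δ b)`: the first factor has filtration one, and the second term is handled by induction.
-/
lemma D_sub_kosz_mem_symFilt_of_le {x₀ : M} {V : Opens M} (hV : V ≤ frameDomain E x₀) (n : ℕ)
    {a : CEAlg E F 𝔤 V} (ha : a ∈ supp E F 𝔤 V (symFilt n)) :
    D.D V a - kosz E F 𝔤 V a ∈ supp E F 𝔤 V (symFilt n) := by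
  induction n generalizing a with
  | zero => exact mem_symFilt_zero _
  | succ n ih =>
    rw [← sum_symEl_mul_frameDiv hV (symFilt_anti (Nat.succ_le_succ n.zero_le) ha), map_sum,
      map_sum, ← Finset.sum_sub_distrib]
    refine Submodule.sum_mem _ fun i _ ↦ ?_
    have hα := isHolDual_frameCovec_of_le hV i
    have hy : (symEl F hα : CEAlg E F 𝔤 V) ∈ supp E F 𝔤 V (bideg 0 0) :=
      symEl_mem_supp _ (by simp [bideg])
    have h : D.D V (symEl F hα * frameDiv hV i a) - kosz E F 𝔤 V (symEl F hα * frameDiv hV i a) =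
        (D.D V (symEl F hα) - formEl F hα) * frameDiv hV i a +
          symEl F hα * (D.D V (frameDiv hV i a) - kosz E F 𝔤 V (frameDiv hV i a)) := by
      rw [D.D_mul V 0 0 _ _ hy, kosz_symEl_mul, add_zero, pow_zero, one_smul, sub_mul, mul_sub]
      abel
    rw [h, add_comm n 1]
    have hd := frameDiv_mem hV i ha
    exact Submodule.add_mem _ (mul_mem_symFilt (D_symEl_sub_formEl_mem D hα) hd)
      (mul_mem_symFilt (symEl_mem_supp _ (by simp [symFilt])) (ih hd))

lemma D_sub_kosz_mem_symFilt {U : Opens M} {n : ℕ} {a : CEAlg E F 𝔤 U}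
    (ha : a ∈ supp E F 𝔤 U (symFilt n)) :
    D.D U a - kosz E F 𝔤 U a ∈ supp E F 𝔤 U (symFilt n) := by
  refine mem_supp_of_local fun x hx ↦
    ⟨U ⊓ frameDomain E x, inf_le_left, ⟨hx, mem_frameDomain x⟩, ?_⟩
  rw [map_sub, ← D.D_res, ← res_kosz]
  exact D_sub_kosz_mem_symFilt_of_le D inf_le_right n (res_mem _ ha)

lemma totD_sub_kosz_mem_symFilt {U : Opens M} {n : ℕ} {a : CEAlg E F 𝔤 U}
    (ha : a ∈ supp E F 𝔤 U (symFilt n)) :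
    totD D U a - kosz E F 𝔤 U a ∈ supp E F 𝔤 U (symFilt n) := by
  rw [totD, LinearMap.add_apply, add_sub_assoc]
  exact Submodule.add_mem _ (Q_mem_symFilt L ha) (D_sub_kosz_mem_symFilt D ha)

/-! ### Compatibility with restriction and with the projection to `Ŝ(𝒲)` -/

lemma totD_res {U V : Opens M} (h : V ≤ U) (a : CEAlg E F 𝔤 U) :
    totD D V (res E F 𝔤 h a) = res E F 𝔤 h (totD D U a) := by
  rw [totD, totD, LinearMap.add_apply, LinearMap.add_apply, L.Q_res, D.D_res, map_add]

/-- An element of the kernel may contain forms without symmetric generators, so it need not have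
filtration one. But `Q` preserves the form degree, so only the part without forms matters; that part
does have filtration one, which `Q` preserves. -/
lemma wQ_eq_zero {U : Opens M} {a : CEAlg E F 𝔤 U} (ha : trunc E F 𝔤 wOnly a = 0) :
    wQ L U a = 0 := by
  refine trunc_wOnly_eq_zero_iff.2 fun m hm ↦ ?_
  have h1 : trunc E F 𝔤 (bideg 0 (m 2 + 1)) a ∈ supp E F 𝔤 U (symFilt 1) := by
    refine mem_supp_iff.2 fun m' hm' ↦ ?_
    by_cases h : bideg 0 (m 2 + 1) m'
    · rw [cf_trunc_of_pos h]
      exact trunc_wOnly_eq_zero_iff.1 ha m' ⟨h.1, Nat.lt_one_iff.1 (not_le.1 hm')⟩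
    · exact cf_trunc_of_neg h a
  rw [← cf_trunc_of_pos (S := bideg 0 (m 2)) ⟨hm.1, rfl⟩, L.Q_deg]
  refine mem_supp_iff.1 (Q_mem_symFilt L h1) m ?_
  simp [symFilt, hm.2]

/-- `D` raises the form degree, so it does not reach the components without forms. -/
lemma trunc_totD {U : Opens M} (a : CEAlg E F 𝔤 U) :
    trunc E F 𝔤 wOnly (totD D U a) = wQ L U a := by
  rw [totD, LinearMap.add_apply, map_add]
  refine add_eq_left.2 (trunc_wOnly_eq_zero_iff.2 fun m hm ↦ ?_)
  rw [← cf_trunc_of_pos (S := bideg 0 (m 2)) ⟨hm.1, rfl⟩, D.D_deg_zero, map_zero]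

lemma trunc_trunc {U : Opens M} (S : Deg → Prop) (a : CEAlg E F 𝔤 U) :
    trunc E F 𝔤 S (trunc E F 𝔤 S a) = trunc E F 𝔤 S a :=
  trunc_eq_self (trunc_mem S a)

lemma wQ_trunc {U : Opens M} (a : CEAlg E F 𝔤 U) :
    wQ L U (trunc E F 𝔤 wOnly a) = wQ L U a := by
  rw [← sub_eq_zero, ← map_sub]
  refine wQ_eq_zero ?_
  rw [map_sub, trunc_trunc, sub_self]

/-- `Q` followed by the projection vanishes on the kernel of the projection, so the projection in
the middle may be dropped and `Q² = 0` applies. -/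
lemma wQ_wQ {U : Opens M} (a : CEAlg E F 𝔤 U) : wQ L U (wQ L U a) = 0 := by
  refine (wQ_trunc (L.Q U a)).trans ?_
  rw [wQ, LinearMap.comp_apply, L.Q_sq, map_zero]

/-! ### Perturbation of the Koszul contraction -/

/-- The deviation of the anticommutator of the total differential and the Koszul homotopy from
the projection to the elements of positive degree in `Ω_M`. -/
def perturbation (U : Opens M) : CEAlg E F 𝔤 U →ₗ[ℂ] CEAlg E F 𝔤 U :=
  totD D U ∘ₗ koszHomotopy E F 𝔤 U + koszHomotopy E F 𝔤 U ∘ₗ totD D U -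
    (LinearMap.id - trunc E F 𝔤 wOnly)

lemma perturbation_apply {U : Opens M} (a : CEAlg E F 𝔤 U) : perturbation D U a =
    totD D U (koszHomotopy E F 𝔤 U a) + koszHomotopy E F 𝔤 U (totD D U a) -
      (a - trunc E F 𝔤 wOnly a) :=
  rfl

/-- Substituting `δh + hδ = 1 - π` leaves the anticommutator of `d - δ` with `h`. The first keeps
the filtration and the second raises it. -/
lemma raisesFilt_perturbation (U : Opens M) : RaisesFilt (perturbation D U) := by
  intro n a ha
  have h : perturbation D U a =
      (totD D U (koszHomotopy E F 𝔤 U a) - kosz E F 𝔤 U (koszHomotopy E F 𝔤 U a)) +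
        koszHomotopy E F 𝔤 U (totD D U a - kosz E F 𝔤 U a) := by
    rw [perturbation_apply, ← kosz_koszHomotopy, map_sub]
    abel
  rw [h]
  exact Submodule.add_mem _ (totD_sub_kosz_mem_symFilt D (koszHomotopy_mem_symFilt ha))
    (koszHomotopy_mem_symFilt (totD_sub_kosz_mem_symFilt D ha))

lemma perturbation_mem_totDeg {U : Opens M} {n : ℤ} {a : CEAlg E F 𝔤 U}
    (ha : a ∈ supp E F 𝔤 U (totDeg n)) : perturbation D U a ∈ supp E F 𝔤 U (totDeg n) := by
  rw [perturbation_apply]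
  refine Submodule.sub_mem _ (Submodule.add_mem _
    (totD_mem D (sub_add_cancel n 1) (koszHomotopy_mem_totDeg (sub_add_cancel n 1) ha))
    (koszHomotopy_mem_totDeg rfl (totD_mem D rfl ha))) (Submodule.sub_mem _ ha ?_)
  refine mem_supp_iff.2 fun m hm ↦ ?_
  by_cases h : wOnly m
  · rw [cf_trunc_of_pos h, mem_supp_iff.1 ha m hm]
  · exact cf_trunc_of_neg h a

lemma perturbation_res {U V : Opens M} (h : V ≤ U) (a : CEAlg E F 𝔤 U) :
    perturbation D V (res E F 𝔤 h a) = res E F 𝔤 h (perturbation D U a) := by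
  simp only [perturbation_apply, map_add, map_sub, res_koszHomotopy, totD_res, trunc_res]

/-- Both sides solve the same equation `x + u x = a` on `V`, whose solution is unique. -/
lemma neumann_perturbation_res {U V : Opens M} (h : V ≤ U) (a : CEAlg E F 𝔤 U) :
    neumann (perturbation D V) (res E F 𝔤 h a) =
      res E F 𝔤 h (neumann (perturbation D U) a) := by
  refine (raisesFilt_perturbation D V).injective ?_
  rw [(raisesFilt_perturbation D V).neumann_add, perturbation_res, ← map_add,
    (raisesFilt_perturbation D U).neumann_add]

lemma add_perturbation {U : Opens M} (a : CEAlg E F 𝔤 U) : a + perturbation D U a =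
    totD D U (koszHomotopy E F 𝔤 U a) + koszHomotopy E F 𝔤 U (totD D U a) +
      trunc E F 𝔤 wOnly a := by
  rw [perturbation_apply]
  abel

/-- Since `h` lands in the kernel of `π` and `d` preserves that kernel, `π (dh + hd) = 0`. Hence `π
(1 + u) = π`. -/
lemma trunc_neumann_perturbation {U : Opens M} (a : CEAlg E F 𝔤 U) :
    trunc E F 𝔤 wOnly (neumann (perturbation D U) a) = trunc E F 𝔤 wOnly a := by
  conv_rhs => rw [← (raisesFilt_perturbation D U).neumann_add a, add_perturbation]
  rw [map_add, map_add, trunc_totD, wQ_eq_zero (trunc_koszHomotopy _), trunc_koszHomotopy,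
    trunc_trunc, zero_add, zero_add]

/-- The contracting homotopy of the kernel of the projection to `Ŝ(𝒲)`. -/
def contraction (U : Opens M) : CEAlg E F 𝔤 U →ₗ[ℂ] CEAlg E F 𝔤 U :=
  koszHomotopy E F 𝔤 U ∘ₗ neumann (perturbation D U)

lemma contraction_apply {U : Opens M} (a : CEAlg E F 𝔤 U) :
    contraction D U a = koszHomotopy E F 𝔤 U (neumann (perturbation D U) a) :=
  rfl

lemma contraction_res {U V : Opens M} (h : V ≤ U) (a : CEAlg E F 𝔤 U) :
    contraction D V (res E F 𝔤 h a) = res E F 𝔤 h (contraction D U a) := by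
  rw [contraction_apply, neumann_perturbation_res, res_koszHomotopy, contraction_apply]

lemma contraction_mem_totDeg {U : Opens M} {i j : ℤ} (hij : i + 1 = j) {a : CEAlg E F 𝔤 U}
    (ha : a ∈ supp E F 𝔤 U (totDeg j)) : contraction D U a ∈ supp E F 𝔤 U (totDeg i) :=
  koszHomotopy_mem_totDeg hij (neumann_mem_supp (fun _ h ↦ perturbation_mem_totDeg D h) ha)

lemma trunc_contraction {U : Opens M} (a : CEAlg E F 𝔤 U) :
    trunc E F 𝔤 wOnly (contraction D U a) = 0 :=
  trunc_koszHomotopy _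

/-- On the kernel of `π`, `1 + u` is `dh + hd`. It commutes with `d`, and so does its inverse, which
then cancels it. -/
lemma totD_contraction {U : Opens M} {a : CEAlg E F 𝔤 U} (ha : trunc E F 𝔤 wOnly a = 0) :
    totD D U (contraction D U a) + contraction D U (totD D U a) = a := by
  set b := neumann (perturbation D U) a with hb
  have hb0 : trunc E F 𝔤 wOnly b = 0 := by rw [hb, trunc_neumann_perturbation, ha]
  have hba : totD D U (koszHomotopy E F 𝔤 U b) + koszHomotopy E F 𝔤 U (totD D U b) = a := by
    have h := (raisesFilt_perturbation D U).neumann_add a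
    rwa [← hb, add_perturbation, hb0, add_zero] at h
  have hd : totD D U b = neumann (perturbation D U) (totD D U a) := by
    refine (raisesFilt_perturbation D U).injective ?_
    rw [(raisesFilt_perturbation D U).neumann_add, add_perturbation, totD_totD, map_zero, add_zero,
      trunc_totD, wQ_eq_zero hb0, add_zero, ← hba, map_add, totD_totD, zero_add]
  rw [contraction_apply, contraction_apply, ← hd, ← hb, hba]

/-! ### The homotopy inverse and the homotopy -/

/-- The homotopy inverse of the projection to `Ŝ(𝒲)`. -/
def inclusion (U : Opens M) : CEAlg E F 𝔤 U →ₗ[ℂ] CEAlg E F 𝔤 U :=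
  -- `d - wQ` measures how far the linear inclusion is from a chain map. Its values lie in the
  -- kernel of `π`, where the contraction can correct them.
  LinearMap.id - contraction D U ∘ₗ (totD D U - wQ L U)

lemma inclusion_apply {U : Opens M} (a : CEAlg E F 𝔤 U) :
    inclusion D U a = a - contraction D U (totD D U a - wQ L U a) :=
  rfl

lemma inclusion_res {U V : Opens M} (h : V ≤ U) (a : CEAlg E F 𝔤 U) :
    inclusion D V (res E F 𝔤 h a) = res E F 𝔤 h (inclusion D U a) := by
  rw [inclusion_apply, inclusion_apply, map_sub (res E F 𝔤 h), ← contraction_res,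
    map_sub (res E F 𝔤 h), totD_res, wQ_res]

lemma mem_totDeg_of_mem_wDeg {U : Opens M} {n : ℤ} {a : CEAlg E F 𝔤 U}
    (ha : a ∈ supp E F 𝔤 U (wDeg n)) : a ∈ supp E F 𝔤 U (totDeg n) := by
  refine fun m hm ↦ ha m ?_
  rintro ⟨⟨h0, -⟩, h2⟩
  apply hm
  unfold totDeg
  omega

lemma trunc_mem_wDeg {U : Opens M} {n : ℤ} {a : CEAlg E F 𝔤 U}
    (ha : a ∈ supp E F 𝔤 U (totDeg n)) : trunc E F 𝔤 wOnly a ∈ supp E F 𝔤 U (wDeg n) := by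
  refine mem_supp_iff.2 fun m hm ↦ ?_
  by_cases h : wOnly m
  · rw [cf_trunc_of_pos h]
    refine mem_supp_iff.1 ha m fun h' ↦ hm ⟨h, ?_⟩
    have := h.1
    unfold totDeg at h'
    omega
  · exact cf_trunc_of_neg h a

lemma trunc_eq_self_of_mem_wDeg {U : Opens M} {n : ℤ} {a : CEAlg E F 𝔤 U}
    (ha : a ∈ supp E F 𝔤 U (wDeg n)) : trunc E F 𝔤 wOnly a = a :=
  trunc_eq_self fun m hm ↦ ha m fun h ↦ hm h.1

lemma inclusion_mem_totDeg {U : Opens M} {n : ℤ} {a : CEAlg E F 𝔤 U}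
    (ha : a ∈ supp E F 𝔤 U (wDeg n)) : inclusion D U a ∈ supp E F 𝔤 U (totDeg n) :=
  Submodule.sub_mem _ (mem_totDeg_of_mem_wDeg ha) (contraction_mem_totDeg D rfl
    (Submodule.sub_mem _ (totD_mem D rfl (mem_totDeg_of_mem_wDeg ha))
      (mem_totDeg_of_mem_wDeg (wQ_mem L rfl ha))))

lemma trunc_wQ {U : Opens M} (a : CEAlg E F 𝔤 U) :
    trunc E F 𝔤 wOnly (wQ L U a) = wQ L U a :=
  trunc_trunc _ _

lemma trunc_inclusion {U : Opens M} (a : CEAlg E F 𝔤 U) :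
    trunc E F 𝔤 wOnly (inclusion D U a) = trunc E F 𝔤 wOnly a := by
  rw [inclusion_apply, map_sub, trunc_contraction, sub_zero]

/-- Apply the contraction identity to `x = d a - wQ a`. As `d x = -d (wQ a)`, the remaining term is
the correction in the inclusion of `wQ a`, because `wQ (wQ a) = 0`. -/
lemma totD_inclusion {U : Opens M} (a : CEAlg E F 𝔤 U) :
    totD D U (inclusion D U a) = inclusion D U (wQ L U a) := by
  have h := totD_contraction D (a := totD D U a - wQ L U a)
    (by rw [map_sub, trunc_totD, trunc_wQ, sub_self])
  rw [map_sub (totD D U), totD_totD, zero_sub, map_neg] at h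
  rw [inclusion_apply, inclusion_apply, wQ_wQ, sub_zero, map_sub (totD D U) a,
    sub_eq_sub_iff_sub_eq_sub]
  exact h.symm.trans (sub_eq_add_neg _ _).symm

/-- The homotopy between the identity and the composition of the projection to `Ŝ(𝒲)` with its
homotopy inverse. -/
def ceHomotopy (U : Opens M) : CEAlg E F 𝔤 U →ₗ[ℂ] CEAlg E F 𝔤 U :=
  contraction D U ∘ₗ (LinearMap.id - inclusion D U ∘ₗ trunc E F 𝔤 wOnly)

lemma ceHomotopy_apply {U : Opens M} (a : CEAlg E F 𝔤 U) :
    ceHomotopy D U a = contraction D U (a - inclusion D U (trunc E F 𝔤 wOnly a)) :=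
  rfl

lemma ceHomotopy_res {U V : Opens M} (h : V ≤ U) (a : CEAlg E F 𝔤 U) :
    ceHomotopy D V (res E F 𝔤 h a) = res E F 𝔤 h (ceHomotopy D U a) := by
  rw [ceHomotopy_apply, ceHomotopy_apply, trunc_res, inclusion_res, ← map_sub, contraction_res]

lemma ceHomotopy_mem_totDeg {U : Opens M} {i j : ℤ} (hij : i + 1 = j) {a : CEAlg E F 𝔤 U}
    (ha : a ∈ supp E F 𝔤 U (totDeg j)) : ceHomotopy D U a ∈ supp E F 𝔤 U (totDeg i) :=
  contraction_mem_totDeg D hij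
    (Submodule.sub_mem _ ha (inclusion_mem_totDeg D (trunc_mem_wDeg ha)))

/-- `1 - ιπ` commutes with `d` and takes values in the kernel of `π`, so the contraction identity
applies to its values. -/
lemma totD_ceHomotopy {U : Opens M} (a : CEAlg E F 𝔤 U) :
    totD D U (ceHomotopy D U a) + ceHomotopy D U (totD D U a) =
      a - inclusion D U (trunc E F 𝔤 wOnly a) := by
  have h := totD_contraction D (a := a - inclusion D U (trunc E F 𝔤 wOnly a))
    (by rw [map_sub, trunc_inclusion, trunc_trunc, sub_self])
  rwa [map_sub (totD D U), totD_inclusion, wQ_trunc, ← trunc_totD D a, ← ceHomotopy_apply,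
    ← ceHomotopy_apply] at h

/-! ### Assembly into complexes of sheaves -/

lemma ceComplex_d {i j : ℤ} (hij : i + 1 = j) : (ceComplex D).d i j =
    suppMap (totD D) (fun h a ↦ totD_res D h a) (fun _ _ ha ↦ totD_mem D hij ha) :=
  dif_pos hij

lemma wComplex_d
    (hL : ∀ (n : ℤ) (U : Opens M), ∀ a ∈ supp E F 𝔤 U (wDeg n), wQ L U (wQ L U a) = 0)
    {i j : ℤ} (hij : i + 1 = j) : (wComplex L hL).d i j =
      suppMap (wQ L) (wQ_res L) (fun _ _ ha ↦ wQ_mem L hij ha) :=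
  dif_pos hij

/-- The projection of the Chevalley--Eilenberg complex to `(Ŝ(𝒲), Q)`. -/
def projHom (hL : ∀ (n : ℤ) (U : Opens M), ∀ a ∈ supp E F 𝔤 U (wDeg n), wQ L U (wQ L U a) = 0) :
    ceComplex D ⟶ wComplex L hL where
  f n := suppMap (fun _ ↦ trunc E F 𝔤 wOnly) (fun h a ↦ trunc_res h wOnly a)
    (fun _ _ ha ↦ trunc_mem_wDeg ha)
  comm' i j hij := by
    rw [ceComplex_d D hij, wComplex_d hL hij]
    ext U a
    apply Subtype.ext
    exact (wQ_trunc a.1).trans (trunc_totD D a.1).symm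

/-- The inclusion of `(Ŝ(𝒲), Q)` in the Chevalley--Eilenberg complex. -/
def inclHom (hL : ∀ (n : ℤ) (U : Opens M), ∀ a ∈ supp E F 𝔤 U (wDeg n), wQ L U (wQ L U a) = 0) :
    wComplex L hL ⟶ ceComplex D where
  f n := suppMap (inclusion D) (fun h a ↦ inclusion_res D h a)
    (fun _ _ ha ↦ inclusion_mem_totDeg D ha)
  comm' i j hij := by
    rw [ceComplex_d D hij, wComplex_d hL hij]
    ext U a
    apply Subtype.ext
    exact totD_inclusion D a.1

/-- This composition is the identity on the nose, since the correction term lies in the kernel of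
the projection; the equivalence is a deformation retraction. -/
lemma inclHom_projHom
    (hL : ∀ (n : ℤ) (U : Opens M), ∀ a ∈ supp E F 𝔤 U (wDeg n), wQ L U (wQ L U a) = 0) :
    inclHom D hL ≫ projHom D hL = 𝟙 _ := by
  ext n U a
  apply Subtype.ext
  exact (trunc_inclusion D a.1).trans (trunc_eq_self_of_mem_wDeg a.2)

/-- The components of the homotopy on the Chevalley--Eilenberg complex. -/
def ceHomotopyHom (i j : ℤ) : (ceComplex D).X i ⟶ (ceComplex D).X j :=
  if h : j + 1 = i then
    suppMap (ceHomotopy D) (fun h a ↦ ceHomotopy_res D h a)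
      (fun _ _ ha ↦ ceHomotopy_mem_totDeg D h ha)
  else 0

lemma ceHomotopyHom_eq {i j : ℤ} (hij : j + 1 = i) : ceHomotopyHom D i j =
    suppMap (ceHomotopy D) (fun h a ↦ ceHomotopy_res D h a)
      (fun _ _ ha ↦ ceHomotopy_mem_totDeg D hij ha) :=
  dif_pos hij

/-- The identity of the Chevalley--Eilenberg complex is homotopic to the projection to `Ŝ(𝒲)`
followed by the inclusion. -/
def homotopyIdProjIncl
    (hL : ∀ (n : ℤ) (U : Opens M), ∀ a ∈ supp E F 𝔤 U (wDeg n), wQ L U (wQ L U a) = 0) :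
    Homotopy (𝟙 (ceComplex D)) (projHom D hL ≫ inclHom D hL) where
  hom := ceHomotopyHom D
  zero i j hij := dif_neg hij
  comm i := by
    rw [dNext_eq _ (show (ComplexShape.up ℤ).Rel i (i + 1) from rfl),
      prevD_eq _ (show (ComplexShape.up ℤ).Rel (i - 1) i from sub_add_cancel i 1),
      ceHomotopyHom_eq D rfl, ceHomotopyHom_eq D (sub_add_cancel i 1), ceComplex_d D rfl,
      ceComplex_d D (sub_add_cancel i 1)]
    ext U a
    apply Subtype.ext
    have h := totD_ceHomotopy D a.1
    rw [eq_sub_iff_add_eq, add_comm (totD D _ _)] at h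
    exact h.symm

/-- The Chevalley--Eilenberg complex of an `L_∞` space is homotopy equivalent to `(Ŝ(𝒲), Q)`. -/
def ceHomotopyEquiv
    (hL : ∀ (n : ℤ) (U : Opens M), ∀ a ∈ supp E F 𝔤 U (wDeg n), wQ L U (wQ L U a) = 0) :
    HomotopyEquiv (ceComplex D) (wComplex L hL) where
  hom := projHom D hL
  inv := inclHom D hL
  homotopyHomInvId := (homotopyIdProjIncl D hL).symm
  homotopyInvHomId := Homotopy.ofEq (inclHom_projHom D hL)

end Contraction

end LInfty

end

theorem theorem3p6
    {E : Type*} [NormedAddCommGroup E] [NormedSpace ℂ E] [FiniteDimensional ℂ E]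
    {M : Type*} [TopologicalSpace M] [ChartedSpace E M] [IsManifold 𝓘(ℂ, E) ω M]
    {r : ℕ} (F : Fin r → Type*) [∀ k, NormedAddCommGroup (F k)] [∀ k, NormedSpace ℂ (F k)]
    [∀ k, FiniteDimensional ℂ (F k)]
    (𝔤 : Fin r → M → Type*) [∀ k, TopologicalSpace (TotalSpace (F k) (𝔤 k))]
    [∀ k x, AddCommGroup (𝔤 k x)] [∀ k x, Module ℂ (𝔤 k x)] [∀ k x, TopologicalSpace (𝔤 k x)]
    [∀ k x, IsTopologicalAddGroup (𝔤 k x)] [∀ k x, ContinuousSMul ℂ (𝔤 k x)]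
    [∀ k, FiberBundle (F k) (𝔤 k)] [∀ k, VectorBundle ℂ (F k) (𝔤 k)]
    [∀ k, ContMDiffVectorBundle ω (F k) (𝔤 k) 𝓘(ℂ, E)]
    (L : LInfty.LInftyStructure E F 𝔤) (D : LInfty.GrothendieckConnection L) :
    ∃ hL : ∀ (n : ℤ) (U : Opens M), ∀ a ∈ LInfty.supp E F 𝔤 U (LInfty.wDeg n),
        LInfty.wQ L U (LInfty.wQ L U a) = 0,
      Nonempty (HomotopyEquiv (LInfty.ceComplex D) (LInfty.wComplex L hL)) := by
  exact ⟨fun _ _ _ _ ↦ LInfty.wQ_wQ _, ⟨LInfty.ceHomotopyEquiv D _⟩⟩
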